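/- Let $0<H<1$ (in particular this covers $1/2<H<1$), $\sigma>0$, $q\ge 1$, let $\lambda_1,\dots,\lambda_q>0$ be pairwise distinct, let $p_1,\dots,p_q\ge 1$ be integers and $p=p_1+\dots+p_q$. Let $(B_H(t))_{t\in\mathbb R}$ be a fractional Brownian motion with Hurst parameter $H$, i.e. an almost surely continuous centered Gaussian process with $\mathbb E(B_H(t)B_H(s))=\tfrac12(|t|^{2H}+|s|^{2H}-|t-s|^{2H})$. For $\lambda>0$ let $T_\lambda(y)(t)=\int_{-\infty}^t e^{-\lambda(t-s)}\,dy(s)$ (pathwise improper Riemann–Stieltjes integral), and let $X\sim\mathrm{FOU}(\lambda_1^{(p_1)},\dots,\lambda_q^{(p_q)},\sigma,H)$, i.e. almost surely $X_t=\big(T_{\lambda_1}^{p_1}\circ\cdots\circ T_{\lambda_q}^{p_q}\big)(\sigma B_H)(t)$ for all $t\in\mathbb R$. Then: 1. $X$ is a centered, square-integrable, wide-sense stationary process with spectral density $$f^{(X)}(x)=\frac{\sigma^2\,\Gamma(2H+1)\sin(H\pi)\,|x|^{2p-1-2H}}{2\pi\prod_{i=1}^q(\lambda_i^2+x^2)^{p_i}},$$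 that is, $f^{(X)}$ is nonnegative and integrable, and $\gamma(t)=\mathbb E(X_0X_t)=\int_{\mathbb R}e^{itx}f^{(X)}(x)\,dx$ for all $t\in\mathbb R$. 2. In particular, if all $p_i=1$ (so $p=q$), then the spectral density is $$f^{(X)}(x)=\frac{\sigma^2\,\Gamma(2H+1)\sin(H\pi)\,|x|^{2p-1-2H}}{2\pi\prod_{i=1}^p(\lambda_i^2+x^2)}.$$ 3. Consequently, if $p\ge 2$, then $f^{(X)}$ has no singularity at $0$ (it is continuous there) and $X$ has short memory: $\sum_{n\in\mathbb Z}|\gamma(n)|<\infty$. -/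

import Mathlib

open MeasureTheory ProbabilityTheory Filter Topology

noncomputable section

namespace FOU

/-- Two-sided fractional Brownian motion with Hurst parameter `H`. -/
structure IsFBM {Ω : Type*} [MeasurableSpace Ω] (P : Measure Ω) (H : ℝ)
    (B : ℝ → Ω → ℝ) : Prop where
  gaussian : IsGaussianProcess B P
  centered : ∀ t, ∫ ω, B t ω ∂P = 0
  covariance : ∀ t s, ∫ ω, B t ω * B s ω ∂P =
    (|t| ^ (2 * H) + |s| ^ (2 * H) - |t - s| ^ (2 * H)) / 2
  continuous_paths : ∀ᵐ ω ∂P, Continuous fun t => B t ω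

/-- `I` is the Riemann–Stieltjes integral of `f` against `y` over `[a, b]`, that is, the limit of
the tagged Riemann–Stieltjes sums as the mesh of the partition tends to zero. -/
def HasRSIntegral (f y : ℝ → ℝ) (a b I : ℝ) : Prop :=
  ∀ ε > 0, ∃ δ > 0, ∀ (n : ℕ) (x τ : ℕ → ℝ), x 0 = a → x n = b →
    (∀ i < n, x i ≤ τ i ∧ τ i ≤ x (i + 1) ∧ x (i + 1) - x i < δ) →
    |∑ i ∈ Finset.range n, f (τ i) * (y (x (i + 1)) - y (x i)) - I| < ε

/-- `I` is the improper Riemann–Stieltjes integral of `f` against `y` over `(-∞, t]`. -/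
def HasImproperRSIntegral (f y : ℝ → ℝ) (t I : ℝ) : Prop :=
  ∃ J : ℝ → ℝ, (∀ a ≤ t, HasRSIntegral f y a t (J a)) ∧ Tendsto J atBot (𝓝 I)

/-- The path `z` is the image `T_l y` of the path `y` under the Ornstein–Uhlenbeck operator:
`z t = ∫_{-∞}^t e^{-l (t - s)} dy(s)` for every `t`. -/
def IsOU (l : ℝ) (y z : ℝ → ℝ) : Prop :=
  ∀ t, HasImproperRSIntegral (fun s => Real.exp (-l * (t - s))) y t (z t)

/-- The path `z` is the image of `y` under the composition `T_{l₁} ∘ T_{l₂} ∘ ⋯` of the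
Ornstein–Uhlenbeck operators whose parameters are listed in the first argument. -/
def IsIteratedOU : List ℝ → (ℝ → ℝ) → (ℝ → ℝ) → Prop
  | [], y, z => z = y
  | l :: L, y, z => ∃ w, IsIteratedOU L y w ∧ IsOU l w z

/-- The list of the parameters `lam i`, each repeated `p i` times. -/
def rates {q : ℕ} (lam : Fin q → ℝ) (p : Fin q → ℕ) : List ℝ :=
  (List.finRange q).flatMap fun i => List.replicate (p i) (lam i)

/-- `X ∼ FOU(lam₁^(p₁), …, lam_q^(p_q), σ, H)`: almost surely, the path of `X` is
`(∏ i, T_{lam i} ^ (p i)) (σ B_H)` for some fractional Brownian motion `B_H`. -/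
def IsFOU {Ω : Type*} [MeasurableSpace Ω] (P : Measure Ω) {q : ℕ}
    (lam : Fin q → ℝ) (p : Fin q → ℕ) (σ H : ℝ) (X : ℝ → Ω → ℝ) : Prop :=
  ∃ B : ℝ → Ω → ℝ, IsFBM P H B ∧
    ∀ᵐ ω ∂P, IsIteratedOU (rates lam p) (fun t => σ * B t ω) (fun t => X t ω)

/-- The auto-covariance function `γ(t) = E(X₀ X_t)` (for a centered stationary process). -/
def autocov {Ω : Type*} [MeasurableSpace Ω] (P : Measure Ω) (X : ℝ → Ω → ℝ) (t : ℝ) : ℝ :=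
  ∫ ω, X 0 ω * X t ω ∂P

/-- Centered square-integrable processes that are stationary in the wide sense. -/
structure IsCenteredStationary {Ω : Type*} [MeasurableSpace Ω] (P : Measure Ω)
    (X : ℝ → Ω → ℝ) : Prop where
  memLp : ∀ t, MemLp (X t) 2 P
  centered : ∀ t, ∫ ω, X t ω ∂P = 0
  stationary : ∀ s t, ∫ ω, X s ω * X (s + t) ω ∂P = autocov P X t

/-- `f` is a spectral density of the centered stationary process `X`: a nonnegative integrable
function with `γ(t) = ∫ e^{itx} f(x) dx` for all real `t`. -/
structure IsSpectralDensity {Ω : Type*} [MeasurableSpace Ω] (P : Measure Ω)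
    (X : ℝ → Ω → ℝ) (f : ℝ → ℝ) : Prop where
  process : IsCenteredStationary P X
  nonneg : ∀ x, 0 ≤ f x
  integrable : Integrable f
  autocov_eq : ∀ t : ℝ, (autocov P X t : ℂ) =
    ∫ x : ℝ, Complex.exp (Complex.I * (t : ℂ) * (x : ℂ)) * (f x : ℂ)

/-- Short memory: the auto-covariances at integer times are absolutely summable. -/
def ShortMemory {Ω : Type*} [MeasurableSpace Ω] (P : Measure Ω) (X : ℝ → Ω → ℝ) : Prop :=
  Summable fun n : ℤ => |autocov P X (n : ℝ)|

/-- The function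
`σ² Γ(2H+1) sin(Hπ) |x|^(2p-1-2H) / (2π ∏ i, (lam i ² + x²)^(p i))`, where `p = ∑ i, p i`. -/
def density {q : ℕ} (lam : Fin q → ℝ) (p : Fin q → ℕ) (σ H x : ℝ) : ℝ :=
  σ ^ 2 * Real.Gamma (2 * H + 1) * Real.sin (H * Real.pi) *
      |x| ^ (2 * ((∑ i, p i : ℕ) : ℝ) - 1 - 2 * H) /
    (2 * Real.pi * ∏ i, (lam i ^ 2 + x ^ 2) ^ (p i))

end FOU

end

/-! The argument is the spectral representation of fractional Brownian motion, carried out without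
stochastic integrals. With `weight` the square root of `weightSq`, the functions `(char t x - 1) *
weight H x` have the same Gram matrix in L²(dx) as the variables B(t) in L²(P). This rests on the
value of the integral of (1 - cos x) x^(-1-2H) over the half-line. The closed real span of the pairs
(B(t), symbol of B(t)) is therefore the graph of an isometry, and covariances can be computed on
symbols.

The pathwise operators enter through `IsRepr.of_tendsto`: if random variables converge almost surely
while their symbols converge under an L² majorant, the limit variable has the limit symbol.
Riemann–Stieltjes sums of exponentials against characters are geometric sums, so T_l multiplies the
symbol of an increment by `mult l x`, that is ix/(l+ix), and replaces the difference of characters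
by e^{itx} (`isRepr_ou`). Iterating, X_t has symbol σ ∏ mult(λ_i, x)^{p_i} e^{itx} weight(x). Its
squared modulus is the density, so E(X_s X_{s+t}) is the cosine transform of the density:
stationarity and the spectral formula follow together.

For p ≥ 2 the density behaves like x^(2p-1-2H) at 0, with exponent above 1, and like x^(-1-2H) at
infinity. Two integrations by parts against the cosine then give γ(t) = O(t⁻²), which is summable
over the integers. -/

noncomputable section

namespace FOU

/-! ### Isometric correspondence between random variables and symbols. -/

section Representation

variable {Ω α ι : Type*} [MeasurableSpace Ω] [MeasurableSpace α]

/-- The closed real linear span of the pairs `(B i, φ i)` in `L²(P) × L²(μ)`. -/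
def reprSpace (P : Measure Ω) (μ : Measure α) (B : ι → Ω → ℝ) (φ : ι → α → ℂ) :
    Submodule ℝ (Lp ℝ 2 P × Lp ℂ 2 μ) :=
  (Submodule.span ℝ {x | ∃ i, x.1 =ᵐ[P] B i ∧ x.2 =ᵐ[μ] φ i}).topologicalClosure

/-- The random variable `Y` is represented by the function `ψ`, with respect to the
correspondence `B i ↦ φ i`. -/
def IsRepr (P : Measure Ω) (μ : Measure α) (B : ι → Ω → ℝ) (φ : ι → α → ℂ)
    (Y : Ω → ℝ) (ψ : α → ℂ) : Prop :=
  ∃ x ∈ reprSpace P μ B φ, x.1 =ᵐ[P] Y ∧ x.2 =ᵐ[μ] ψ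

variable {P : Measure Ω} {μ : Measure α} {B : ι → Ω → ℝ} {φ : ι → α → ℂ}

/-- The correspondence `B i ↦ φ i` preserves inner products, and the `B i` are centered. -/
structure IsIsometric (P : Measure Ω) (μ : Measure α) (B : ι → Ω → ℝ) (φ : ι → α → ℂ) :
    Prop where
  memLp_left : ∀ i, MemLp (B i) 2 P
  memLp_right : ∀ i, MemLp (φ i) 2 μ
  centered : ∀ i, ∫ ω, B i ω ∂P = 0
  inner_eq : ∀ i j, ∫ ω, B i ω * B j ω ∂P = ∫ x, (inner ℝ (φ i x) (φ j x) : ℝ) ∂μ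

theorem IsIsometric.isRepr (h : IsIsometric P μ B φ) (i : ι) : IsRepr P μ B φ (B i) (φ i) :=
  ⟨((h.memLp_left i).toLp _, (h.memLp_right i).toLp _),
    Submodule.le_topologicalClosure _ (Submodule.subset_span
      ⟨i, (h.memLp_left i).coeFn_toLp, (h.memLp_right i).coeFn_toLp⟩),
    (h.memLp_left i).coeFn_toLp, (h.memLp_right i).coeFn_toLp⟩

/-- Both sides are bilinear and continuous, so equality on generators passes to the span, then to
the closure in one variable at a time. -/
theorem inner_eq_of_mem_reprSpace (h : IsIsometric P μ B φ) {x y : Lp ℝ 2 P × Lp ℂ 2 μ}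
    (hx : x ∈ reprSpace P μ B φ) (hy : y ∈ reprSpace P μ B φ) :
    (inner ℝ x.1 y.1 : ℝ) = inner ℝ x.2 y.2 := by
  have gen : ∀ x ∈ {x : Lp ℝ 2 P × Lp ℂ 2 μ | ∃ i, x.1 =ᵐ[P] B i ∧ x.2 =ᵐ[μ] φ i},
      ∀ y ∈ {x : Lp ℝ 2 P × Lp ℂ 2 μ | ∃ i, x.1 =ᵐ[P] B i ∧ x.2 =ᵐ[μ] φ i},
      (inner ℝ x.1 y.1 : ℝ) = inner ℝ x.2 y.2 := by
    rintro x ⟨i, hi, hi'⟩ y ⟨j, hj, hj'⟩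
    rw [L2.inner_def, L2.inner_def]
    have e := h.inner_eq i j
    calc _ = ∫ ω, B i ω * B j ω ∂P := by
          refine integral_congr_ae ?_
          filter_upwards [hi, hj] with ω h1 h2
          rw [h1, h2]; simp [mul_comm]
      _ = _ := by
          rw [e]
          refine integral_congr_ae ?_
          filter_upwards [hi', hj'] with ω h1 h2
          rw [h1, h2]
  have span : ∀ x ∈ Submodule.span ℝ
        {x : Lp ℝ 2 P × Lp ℂ 2 μ | ∃ i, x.1 =ᵐ[P] B i ∧ x.2 =ᵐ[μ] φ i},
      ∀ y ∈ Submodule.span ℝ {x : Lp ℝ 2 P × Lp ℂ 2 μ | ∃ i, x.1 =ᵐ[P] B i ∧ x.2 =ᵐ[μ] φ i},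
      (inner ℝ x.1 y.1 : ℝ) = inner ℝ x.2 y.2 := by
    intro x hx y hy
    induction hx, hy using Submodule.span_induction₂ with
    | mem_mem x y hx hy => exact gen x hx y hy
    | zero_left y hy => simp
    | zero_right x hx => simp
    | add_left x y z _ _ _ h1 h2 => simp [inner_add_left, h1, h2]
    | add_right x y z _ _ _ h1 h2 => simp [inner_add_right, h1, h2]
    | smul_left r x y _ _ h1 => simp [real_inner_smul_left, h1]
    | smul_right r x y _ _ h1 => simp [real_inner_smul_right, h1]
  have step : ∀ x ∈ Submodule.span ℝ
        {x : Lp ℝ 2 P × Lp ℂ 2 μ | ∃ i, x.1 =ᵐ[P] B i ∧ x.2 =ᵐ[μ] φ i},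
      ∀ y ∈ reprSpace P μ B φ, (inner ℝ x.1 y.1 : ℝ) = inner ℝ x.2 y.2 := by
    intro x hx y hy
    have hc : IsClosed {y : Lp ℝ 2 P × Lp ℂ 2 μ | (inner ℝ x.1 y.1 : ℝ) = inner ℝ x.2 y.2} :=
      isClosed_eq (by fun_prop) (by fun_prop)
    exact closure_minimal (fun y hy => span x hx y hy) hc hy
  have hc : IsClosed {x : Lp ℝ 2 P × Lp ℂ 2 μ | (inner ℝ x.1 y.1 : ℝ) = inner ℝ x.2 y.2} :=
    isClosed_eq (by fun_prop) (by fun_prop)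
  exact closure_minimal (fun x hx => step x hx y hy) hc hx

theorem norm_eq_of_mem_reprSpace (h : IsIsometric P μ B φ) {x : Lp ℝ 2 P × Lp ℂ 2 μ}
    (hx : x ∈ reprSpace P μ B φ) : ‖x.1‖ = ‖x.2‖ := by
  have := inner_eq_of_mem_reprSpace h hx hx
  rw [real_inner_self_eq_norm_sq, real_inner_self_eq_norm_sq] at this
  exact (sq_eq_sq₀ (norm_nonneg _) (norm_nonneg _)).1 this

/-- The mean is the inner product with the constant 1, hence a continuous functional that vanishes
on the generators. -/
theorem integral_eq_zero_of_mem_reprSpace [IsFiniteMeasure P] (h : IsIsometric P μ B φ)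
    {x : Lp ℝ 2 P × Lp ℂ 2 μ} (hx : x ∈ reprSpace P μ B φ) : ∫ ω, x.1 ω ∂P = 0 := by
  set c : Lp ℝ 2 P := (memLp_const (1 : ℝ)).toLp _ with hcdef
  have key : ∀ y : Lp ℝ 2 P, ∫ ω, y ω ∂P = inner ℝ c y := by
    intro y
    rw [L2.inner_def]
    refine integral_congr_ae ?_
    filter_upwards [(memLp_const (1 : ℝ) : MemLp _ 2 P).coeFn_toLp] with ω hω
    rw [hcdef, hω]; simp
  rw [key]
  have hc : IsClosed {x : Lp ℝ 2 P × Lp ℂ 2 μ | (inner ℝ c x.1 : ℝ) = 0} :=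
    isClosed_eq (by fun_prop) (by fun_prop)
  refine closure_minimal (fun x hx => ?_) hc hx
  change (inner ℝ c x.1 : ℝ) = 0
  induction hx using Submodule.span_induction with
  | mem x hx =>
    obtain ⟨i, hi, _⟩ := hx
    rw [← key, integral_congr_ae hi, h.centered]
  | zero => simp
  | add x y _ _ hx hy => simp [inner_add_right, hx, hy]
  | smul r x _ hx => simp [real_inner_smul_right, hx]

namespace IsRepr

variable {Y Y' : Ω → ℝ} {ψ ψ' : α → ℂ}

theorem congr (h : IsRepr P μ B φ Y ψ) (hY : Y =ᵐ[P] Y') (hψ : ψ =ᵐ[μ] ψ') :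
    IsRepr P μ B φ Y' ψ' := by
  obtain ⟨x, hx, h1, h2⟩ := h
  exact ⟨x, hx, h1.trans hY, h2.trans hψ⟩

theorem memLp (h : IsRepr P μ B φ Y ψ) : MemLp Y 2 P := by
  obtain ⟨x, hx, h1, h2⟩ := h
  exact (memLp_congr_ae h1).1 (Lp.memLp _)

theorem memLp_right (h : IsRepr P μ B φ Y ψ) : MemLp ψ 2 μ := by
  obtain ⟨x, hx, h1, h2⟩ := h
  exact (memLp_congr_ae h2).1 (Lp.memLp _)

theorem add (h : IsRepr P μ B φ Y ψ) (h' : IsRepr P μ B φ Y' ψ') :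
    IsRepr P μ B φ (fun ω => Y ω + Y' ω) (fun x => ψ x + ψ' x) := by
  obtain ⟨x, hx, h1, h2⟩ := h
  obtain ⟨x', hx', h1', h2'⟩ := h'
  exact ⟨x + x', add_mem hx hx', (Lp.coeFn_add _ _).trans (h1.add h1'),
    (Lp.coeFn_add _ _).trans (h2.add h2')⟩

theorem const_mul (h : IsRepr P μ B φ Y ψ) (c : ℝ) :
    IsRepr P μ B φ (fun ω => c * Y ω) (fun x => (c : ℂ) * ψ x) := by
  obtain ⟨x, hx, h1, h2⟩ := h
  refine ⟨c • x, Submodule.smul_mem _ _ hx, (Lp.coeFn_smul _ _).trans (h1.const_smul c),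
    (Lp.coeFn_smul _ _).trans ?_⟩
  filter_upwards [h2] with a ha
  simp [ha]

theorem sub (h : IsRepr P μ B φ Y ψ) (h' : IsRepr P μ B φ Y' ψ') :
    IsRepr P μ B φ (fun ω => Y ω - Y' ω) (fun x => ψ x - ψ' x) := by
  refine (h.add (h'.const_mul (-1))).congr (ae_of_all _ fun _ => ?_) (ae_of_all _ fun _ => ?_) <;>
  · simp; ring

theorem zero : IsRepr P μ B φ (fun _ => 0) (fun _ => 0) :=
  ⟨0, zero_mem _, Lp.coeFn_zero _ _ _, Lp.coeFn_zero _ _ _⟩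

theorem sum {κ : Type*} (s : Finset κ) {Y : κ → Ω → ℝ} {ψ : κ → α → ℂ}
    (h : ∀ k ∈ s, IsRepr P μ B φ (Y k) (ψ k)) :
    IsRepr P μ B φ (fun ω => ∑ k ∈ s, Y k ω) (fun x => ∑ k ∈ s, ψ k x) := by
  classical
  induction s using Finset.induction_on with
  | empty => simpa using zero
  | insert a s ha ih =>
    simp only [Finset.sum_insert ha]
    exact (h a (by simp)).add (ih fun k hk => h k (by simp [hk]))

theorem integral_mul (hB : IsIsometric P μ B φ) (h : IsRepr P μ B φ Y ψ)
    (h' : IsRepr P μ B φ Y' ψ') :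
    ∫ ω, Y ω * Y' ω ∂P = ∫ x, (inner ℝ (ψ x) (ψ' x) : ℝ) ∂μ := by
  obtain ⟨x, hx, h1, h2⟩ := h
  obtain ⟨x', hx', h1', h2'⟩ := h'
  have := inner_eq_of_mem_reprSpace hB hx hx'
  rw [L2.inner_def, L2.inner_def] at this
  calc _ = ∫ ω, (inner ℝ (x.1 ω) (x'.1 ω) : ℝ) ∂P := by
        refine integral_congr_ae ?_
        filter_upwards [h1, h1'] with ω e1 e2
        rw [e1, e2]; simp [mul_comm]
    _ = _ := by
        rw [this]
        refine integral_congr_ae ?_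
        filter_upwards [h2, h2'] with ω e1 e2
        rw [e1, e2]

theorem integral_eq_zero [IsFiniteMeasure P] (hB : IsIsometric P μ B φ)
    (h : IsRepr P μ B φ Y ψ) : ∫ ω, Y ω ∂P = 0 := by
  obtain ⟨x, hx, h1, -⟩ := h
  rw [← integral_congr_ae h1]
  exact integral_eq_zero_of_mem_reprSpace hB hx

end IsRepr

theorem tendsto_toLp_of_dominated {ψ : ℕ → α → ℂ} {ψ₀ : α → ℂ} {D : α → ℝ}
    (hψ : ∀ n, MemLp (ψ n) 2 μ) (hψ₀ : MemLp ψ₀ 2 μ) (hD : MemLp D 2 μ)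
    (hbd : ∀ n, ∀ᵐ x ∂μ, ‖ψ n x‖ ≤ D x)
    (hlim : ∀ᵐ x ∂μ, Tendsto (fun n => ψ n x) atTop (𝓝 (ψ₀ x))) :
    Tendsto (fun n => (hψ n).toLp (ψ n)) atTop (𝓝 (hψ₀.toLp ψ₀)) := by
  rw [tendsto_iff_norm_sub_tendsto_zero]
  have hsq : ∀ n, ‖(hψ n).toLp (ψ n) - hψ₀.toLp ψ₀‖ =
      Real.sqrt (∫ x, ‖ψ n x - ψ₀ x‖ ^ 2 ∂μ) := by
    intro n
    rw [← Real.sqrt_sq (norm_nonneg ((hψ n).toLp (ψ n) - hψ₀.toLp ψ₀)),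
      ← real_inner_self_eq_norm_sq, L2.inner_def]
    congr 1
    refine integral_congr_ae ?_
    rw [← MemLp.toLp_sub]
    filter_upwards [((hψ n).sub hψ₀).coeFn_toLp] with x hx
    rw [hx, real_inner_self_eq_norm_sq]; rfl
  simp_rw [hsq]
  rw [← Real.sqrt_zero]
  refine (Real.continuous_sqrt.tendsto 0).comp ?_
  rw [show (0 : ℝ) = ∫ x, (0 : ℝ) ∂μ by simp]
  refine tendsto_integral_of_dominated_convergence (fun x => (2 * D x) ^ 2) ?_ ?_ ?_ ?_
  · intro n
    exact (((hψ n).1.sub hψ₀.1).norm).pow 2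
  · exact (hD.const_mul 2).integrable_sq
  · intro n
    filter_upwards [hbd n, ae_all_iff.2 hbd, hlim] with x h1 h2 h3
    have h4 : ‖ψ₀ x‖ ≤ D x := le_of_tendsto h3.norm (Eventually.of_forall h2)
    rw [Real.norm_of_nonneg (by positivity)]
    refine pow_le_pow_left₀ (norm_nonneg _) ?_ 2
    calc _ ≤ ‖ψ n x‖ + ‖ψ₀ x‖ := norm_sub_le _ _
      _ ≤ _ := by linarith
  · filter_upwards [hlim] with x hx
    have := ((hx.sub_const (ψ₀ x)).norm).pow 2
    simpa using this

/-- Only almost sure convergence is available on the probability side. Domination makes the symbols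
converge in L², and the isometry turns this into L² convergence of the variables. Neither
measurability nor a moment of the limit `Y₀` has to be assumed. -/
theorem IsRepr.of_tendsto (hB : IsIsometric P μ B φ) {Y : ℕ → Ω → ℝ} {Y₀ : Ω → ℝ}
    {ψ : ℕ → α → ℂ} {ψ₀ : α → ℂ} {D : α → ℝ} (h : ∀ n, IsRepr P μ B φ (Y n) (ψ n))
    (hY : ∀ᵐ ω ∂P, Tendsto (fun n => Y n ω) atTop (𝓝 (Y₀ ω))) (hD : MemLp D 2 μ)
    (hbd : ∀ n, ∀ᵐ x ∂μ, ‖ψ n x‖ ≤ D x)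
    (hlim : ∀ᵐ x ∂μ, Tendsto (fun n => ψ n x) atTop (𝓝 (ψ₀ x))) :
    IsRepr P μ B φ Y₀ ψ₀ := by
  have hψ := fun n => (h n).memLp_right
  have hψ₀ : MemLp ψ₀ 2 μ := by
    refine hD.mono (aestronglyMeasurable_of_tendsto_ae atTop (fun n => (hψ n).1) hlim) ?_
    filter_upwards [ae_all_iff.2 hbd, hlim] with x h2 h3
    exact (le_of_tendsto h3.norm (Eventually.of_forall h2)).trans (le_abs_self _)
  have hlimψ := tendsto_toLp_of_dominated hψ hψ₀ hD hbd hlim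
  choose x hx hx1 hx2 using h
  have hx2' : ∀ n, (x n).2 = (hψ n).toLp (ψ n) := fun n =>
    Lp.ext ((hx2 n).trans (hψ n).coeFn_toLp.symm)
  have hlim2 : Tendsto (fun n => (x n).2) atTop (𝓝 (hψ₀.toLp ψ₀)) := by
    simpa only [hx2'] using hlimψ
  have hcau : CauchySeq fun n => (x n).1 := by
    have := hlim2.cauchySeq
    rw [Metric.cauchySeq_iff] at this ⊢
    intro ε hε
    obtain ⟨N, hN⟩ := this ε hε
    refine ⟨N, fun m hm n hn => ?_⟩
    -- Differences stay in the space, so the Cauchy property moves across the isometry.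
    have h1 := norm_eq_of_mem_reprSpace hB (sub_mem (hx m) (hx n))
    have h2 := hN m hm n hn
    rw [dist_eq_norm] at h2 ⊢
    rw [Prod.fst_sub, Prod.snd_sub] at h1
    rw [h1]
    exact h2
  obtain ⟨y, hy⟩ := cauchySeq_tendsto_of_complete hcau
  refine ⟨(y, hψ₀.toLp ψ₀), ?_, ?_, hψ₀.coeFn_toLp⟩
  · refine (Submodule.isClosed_topologicalClosure _).mem_of_tendsto (b := atTop) (f := x) ?_
      (Eventually.of_forall hx)
    exact (hy.prodMk_nhds hlim2)
  -- A subsequence of the L²-convergent sequence converges almost surely, which identifies its limit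
  -- with `Y₀`.
  · have hm := tendstoInMeasure_of_tendsto_Lp hy
    obtain ⟨ns, hns, hae⟩ := hm.exists_seq_tendsto_ae
    filter_upwards [hae, hY, ae_all_iff.2 hx1] with ω h1 h2 h3
    have h4 := h2.comp hns.tendsto_atTop
    refine tendsto_nhds_unique h1 (h4.congr fun n => ?_)
    exact (h3 (ns n)).symm

end Representation

/-! ### The cosine integral behind the variance of fractional Brownian motion. -/

section FractionalIntegral

open Set Real

/-- A non-integrable function has Bochner integral 0 by convention, so a positive value already
certifies integrability. -/
theorem lintegral_ofReal_Ioi_of_integral_eq {f : ℝ → ℝ} {c : ℝ} (hf : ∀ x ∈ Ioi (0 : ℝ), 0 ≤ f x)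
    (hc : 0 < c) (h : ∫ x in Ioi (0 : ℝ), f x = c) :
    ∫⁻ x in Ioi (0 : ℝ), ENNReal.ofReal (f x) = ENNReal.ofReal c := by
  have hi : IntegrableOn f (Ioi 0) := by
    by_contra hn
    rw [integral_undef hn] at h
    exact hc.ne h
  rw [← h, ofReal_integral_eq_lintegral_ofReal hi]
  filter_upwards [ae_restrict_mem measurableSet_Ioi] with x hx using hf x hx

theorem lintegral_rpow_mul_exp {s r : ℝ} (hs : 0 < s) (hr : 0 < r) :
    ∫⁻ u in Ioi (0 : ℝ), ENNReal.ofReal (u ^ (s - 1) * exp (-(r * u))) =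
      ENNReal.ofReal (r ^ (-s) * Gamma s) := by
  refine lintegral_ofReal_Ioi_of_integral_eq (fun u hu => ?_) ?_ ?_
  · have : 0 < u := hu
    positivity
  · have := Gamma_pos_of_pos hs
    positivity
  · rw [integral_rpow_mul_exp_neg_mul_Ioi hs hr, one_div, inv_rpow hr.le, rpow_neg hr.le]

theorem integral_one_sub_cos_mul_exp {u : ℝ} (hu : 0 < u) :
    ∫ x in Ioi (0 : ℝ), (1 - cos x) * exp (-(u * x)) = 1 / (u * (1 + u ^ 2)) := by
  have h1 : IntegrableOn (fun x : ℝ => exp (-u * x)) (Ioi 0) :=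
    integrableOn_exp_mul_Ioi (by linarith) 0
  have hre : (-(u : ℂ) + Complex.I).re < 0 := by simpa using hu
  have h2 : IntegrableOn (fun x : ℝ => Complex.exp ((-(u : ℂ) + Complex.I) * x)) (Ioi 0) :=
    integrableOn_exp_mul_complex_Ioi hre 0
  have e1 : ∫ x in Ioi (0 : ℝ), exp (-u * x) = 1 / u := by
    rw [integral_exp_mul_Ioi (by linarith)]; simp
  have e2 : ∫ x in Ioi (0 : ℝ), (Complex.exp ((-(u : ℂ) + Complex.I) * x)).re =
      u / (1 + u ^ 2) := by
    have := integral_exp_mul_complex_Ioi hre 0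
    have h3 := integral_re (𝕜 := ℂ) h2
    simp only [RCLike.re_eq_complex_re] at h3
    rw [h3, this]
    simp [Complex.div_re, Complex.normSq_apply]
    ring_nf
  have e3 : ∀ x : ℝ, (1 - cos x) * exp (-(u * x)) =
      exp (-u * x) - (Complex.exp ((-(u : ℂ) + Complex.I) * x)).re := by
    intro x
    rw [Complex.exp_re]
    simp
    ring
  simp_rw [e3]
  have h2' : IntegrableOn (fun x : ℝ => (Complex.exp ((-(u : ℂ) + Complex.I) * x)).re) (Ioi 0) :=
    h2.re
  rw [integral_sub h1 h2', e1, e2]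
  field_simp
  ring

/-- Write 1/(1+u²) as the integral of e^{-(1+u²)w} over w > 0 and apply Tonelli. The Gaussian moment
in u gives Γ(H)/2, the integral in w gives Γ(1-H), and the reflection formula concludes. -/
theorem lintegral_rpow_div_one_add_sq {H : ℝ} (h0 : 0 < H) (h1 : H < 1) :
    ∫⁻ u in Ioi (0 : ℝ), ENNReal.ofReal (u ^ (2 * H - 1) / (1 + u ^ 2)) =
      ENNReal.ofReal (π / (2 * sin (π * H))) := by
  have e1 : ∀ u ∈ Ioi (0 : ℝ), ENNReal.ofReal (u ^ (2 * H - 1) / (1 + u ^ 2)) =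
      ∫⁻ w in Ioi (0 : ℝ), ENNReal.ofReal (u ^ (2 * H - 1) * exp (-((1 + u ^ 2) * w))) := by
    intro u hu
    have hu' : 0 < u := hu
    have := lintegral_rpow_mul_exp (s := 1) (r := 1 + u ^ 2) one_pos (by positivity)
    simp only [sub_self, rpow_zero, one_mul, Gamma_one, mul_one, rpow_neg_one] at this
    simp_rw [ENNReal.ofReal_mul (rpow_nonneg hu'.le (2 * H - 1))]
    rw [lintegral_const_mul _ (by fun_prop), this, div_eq_mul_inv,
      ENNReal.ofReal_mul (rpow_nonneg hu'.le _)]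
  rw [setLIntegral_congr_fun measurableSet_Ioi e1, lintegral_lintegral_swap]
  · have e2 : ∀ w ∈ Ioi (0 : ℝ),
        ∫⁻ u in Ioi (0 : ℝ), ENNReal.ofReal (u ^ (2 * H - 1) * exp (-((1 + u ^ 2) * w))) =
        ENNReal.ofReal (Gamma H / 2) * ENNReal.ofReal (w ^ ((1 - H) - 1) * exp (-(1 * w))) := by
      intro w hw
      have hw' : 0 < w := hw
      have hG := Gamma_pos_of_pos h0
      rw [← ENNReal.ofReal_mul (by positivity)]
      refine lintegral_ofReal_Ioi_of_integral_eq (fun u hu => ?_) (by positivity) ?_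
      · have : 0 < u := hu
        positivity
      · have := integral_rpow_mul_exp_neg_mul_rpow (p := 2) (q := 2 * H - 1) (b := w)
          (by norm_num) (by linarith) hw'
        calc _ = ∫ u in Ioi (0 : ℝ), exp (-w) * (u ^ (2 * H - 1) * exp (-w * u ^ (2 : ℝ))) := by
              congr 1; ext u
              rw [rpow_two, mul_left_comm, ← exp_add]
              ring_nf
          _ = _ := by
              rw [integral_const_mul, this]
              rw [show -(2 * H - 1 + 1) / 2 = 1 - H - 1 by ring,
                show (2 * H - 1 + 1) / 2 = H by ring, one_mul]
              ring
    rw [setLIntegral_congr_fun measurableSet_Ioi e2, lintegral_const_mul _ (by fun_prop),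
      lintegral_rpow_mul_exp (by linarith) one_pos, one_rpow, one_mul,
      ← ENNReal.ofReal_mul (by have := Gamma_pos_of_pos h0; positivity)]
    congr 1
    rw [div_mul_eq_mul_div, Gamma_mul_Gamma_one_sub]
    field_simp
  · apply Measurable.aemeasurable
    unfold Function.uncurry
    fun_prop

/-- Write x^(-1-2H) as a Gamma integral of u^(2H) e^{-xu} and apply Tonelli; the inner integral is
the Laplace transform of 1 - cos. Working with `lintegral` yields integrability from finiteness
afterwards. -/
theorem lintegral_one_sub_cos_mul_rpow {H : ℝ} (h0 : 0 < H) (h1 : H < 1) :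
    ∫⁻ x in Ioi (0 : ℝ), ENNReal.ofReal ((1 - cos x) * x ^ (-1 - 2 * H)) =
      ENNReal.ofReal (π / (2 * Gamma (2 * H + 1) * sin (π * H))) := by
  have hG : 0 < Gamma (2 * H + 1) := Gamma_pos_of_pos (by linarith)
  have hc : ∀ x, 0 ≤ 1 - cos x := fun x => by linarith [cos_le_one x]
  have e1 : ∀ x ∈ Ioi (0 : ℝ), ENNReal.ofReal ((1 - cos x) * x ^ (-1 - 2 * H)) =
      ∫⁻ u in Ioi (0 : ℝ), ENNReal.ofReal
        ((1 - cos x) / Gamma (2 * H + 1) * (u ^ (2 * H + 1 - 1) * exp (-(x * u)))) := by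
    intro x hx
    have hx' : 0 < x := hx
    have := lintegral_rpow_mul_exp (s := 2 * H + 1) (r := x) (by linarith) hx'
    simp_rw [ENNReal.ofReal_mul (div_nonneg (hc x) hG.le)]
    rw [lintegral_const_mul _ (by fun_prop), this,
      ← ENNReal.ofReal_mul (div_nonneg (hc x) hG.le)]
    congr 1
    rw [show -(2 * H + 1) = -1 - 2 * H by ring]
    field_simp
  rw [setLIntegral_congr_fun measurableSet_Ioi e1, lintegral_lintegral_swap]
  · have e2 : ∀ u ∈ Ioi (0 : ℝ),
        ∫⁻ x in Ioi (0 : ℝ), ENNReal.ofReal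
          ((1 - cos x) / Gamma (2 * H + 1) * (u ^ (2 * H + 1 - 1) * exp (-(x * u)))) =
        ENNReal.ofReal (1 / Gamma (2 * H + 1)) *
          ENNReal.ofReal (u ^ (2 * H - 1) / (1 + u ^ 2)) := by
      intro u hu
      have hu' : 0 < u := hu
      rw [← ENNReal.ofReal_mul (by positivity)]
      refine lintegral_ofReal_Ioi_of_integral_eq (fun x hx => ?_) (by positivity) ?_
      · have := hc x
        positivity
      · calc _ = ∫ x in Ioi (0 : ℝ), u ^ (2 * H) / Gamma (2 * H + 1) *
                ((1 - cos x) * exp (-(u * x))) := by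
              congr 1; ext x
              rw [show 2 * H + 1 - 1 = 2 * H by ring, mul_comm x u]
              ring
          _ = _ := by
              rw [integral_const_mul, integral_one_sub_cos_mul_exp hu', rpow_sub_one hu'.ne']
              field_simp
    rw [setLIntegral_congr_fun measurableSet_Ioi e2, lintegral_const_mul _ (by fun_prop),
      lintegral_rpow_div_one_add_sq h0 h1, ← ENNReal.ofReal_mul (by positivity)]
    congr 1
    field_simp
  · apply Measurable.aemeasurable
    unfold Function.uncurry
    fun_prop

theorem sin_mul_pi_pos {H : ℝ} (h0 : 0 < H) (h1 : H < 1) : 0 < sin (π * H) :=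
  sin_pos_of_pos_of_lt_pi (by positivity) (by nlinarith [pi_pos])

theorem integrableOn_one_sub_cos_mul_rpow {H : ℝ} (h0 : 0 < H) (h1 : H < 1) :
    IntegrableOn (fun x => (1 - cos x) * x ^ (-1 - 2 * H)) (Ioi 0) := by
  refine ⟨Measurable.aestronglyMeasurable (by fun_prop), ?_⟩
  rw [hasFiniteIntegral_iff_ofReal, lintegral_one_sub_cos_mul_rpow h0 h1]
  · exact ENNReal.ofReal_lt_top
  · filter_upwards [ae_restrict_mem measurableSet_Ioi] with x hx
    exact mul_nonneg (by linarith [cos_le_one x]) (rpow_nonneg (le_of_lt hx) _)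

theorem integral_one_sub_cos_mul_rpow {H : ℝ} (h0 : 0 < H) (h1 : H < 1) :
    ∫ x in Ioi (0 : ℝ), (1 - cos x) * x ^ (-1 - 2 * H) =
      π / (2 * Gamma (2 * H + 1) * sin (π * H)) := by
  have hG : 0 < Gamma (2 * H + 1) := Gamma_pos_of_pos (by linarith)
  have hS := sin_mul_pi_pos h0 h1
  rw [integral_eq_lintegral_of_nonneg_ae, lintegral_one_sub_cos_mul_rpow h0 h1,
    ENNReal.toReal_ofReal (by positivity)]
  · filter_upwards [ae_restrict_mem measurableSet_Ioi] with x hx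
    exact mul_nonneg (by linarith [cos_le_one x]) (rpow_nonneg (le_of_lt hx) _)
  · exact Measurable.aestronglyMeasurable (by fun_prop)

/-- The square of the spectral weight of fractional Brownian motion. -/
def weightSq (H x : ℝ) : ℝ :=
  Gamma (2 * H + 1) * sin (π * H) / (2 * π) * |x| ^ (-1 - 2 * H)

theorem weightSq_nonneg {H : ℝ} (h0 : 0 < H) (h1 : H < 1) (x : ℝ) : 0 ≤ weightSq H x := by
  have hG : 0 < Gamma (2 * H + 1) := Gamma_pos_of_pos (by linarith)
  have hS := sin_mul_pi_pos h0 h1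
  unfold weightSq
  positivity

@[fun_prop]
theorem measurable_weightSq (H : ℝ) : Measurable (weightSq H) := by
  unfold weightSq; fun_prop

theorem integrable_comp_abs {f : ℝ → ℝ} (hf : IntegrableOn f (Ioi 0)) :
    Integrable fun x => f |x| := by
  rw [← integrableOn_univ, ← Iic_union_Ioi (a := (0 : ℝ)), integrableOn_union]
  constructor
  · rw [integrableOn_Iic_iff_integrableOn_Iio]
    have h : IntegrableOn (fun x => f (-x)) (Iio 0) := by
      have := hf.comp_neg
      simpa using this
    exact h.congr_fun (fun x hx => by simp [abs_of_neg (show x < 0 from hx)]) measurableSet_Iio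
  · exact hf.congr_fun (fun x hx => by simp [abs_of_pos (show 0 < x from hx)]) measurableSet_Ioi

/-- Evenness reduces to the half-line, and the substitution y = |t|x produces the factor |t|^(2H).
-/
theorem integral_one_sub_cos_mul_weightSq_aux {H t : ℝ} (h0 : 0 < H) (h1 : H < 1) (ht : t ≠ 0) :
    Integrable (fun x => (1 - cos (t * x)) * weightSq H x) ∧
    ∫ x, (1 - cos (t * x)) * weightSq H x = |t| ^ (2 * H) / 2 := by
  have ht' : 0 < |t| := abs_pos.2 ht
  have hG : 0 < Gamma (2 * H + 1) := Gamma_pos_of_pos (by linarith)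
  have hS := sin_mul_pi_pos h0 h1
  set C := Gamma (2 * H + 1) * sin (π * H) / (2 * π) with hC
  let F : ℝ → ℝ := fun y => C * |t| ^ (1 + 2 * H) * ((1 - cos y) * y ^ (-1 - 2 * H))
  have e : ∀ x, (1 - cos (t * x)) * weightSq H x = (fun y => F (|t| * y)) |x| := by
    intro x
    simp only [F]
    rw [← abs_mul, cos_abs, abs_mul, mul_rpow ht'.le (abs_nonneg x), weightSq, ← hC,
      show -1 - 2 * H = -(1 + 2 * H) by ring, rpow_neg ht'.le]
    field_simp
  have hi : IntegrableOn F (Ioi 0) := (integrableOn_one_sub_cos_mul_rpow h0 h1).const_mul _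
  simp_rw [e]
  constructor
  · exact integrable_comp_abs ((integrableOn_Ioi_comp_mul_left_iff F 0 ht').2 (by simpa using hi))
  · rw [integral_comp_abs (f := fun y => F (|t| * y)), integral_comp_mul_left_Ioi F 0 ht',
      mul_zero, integral_const_mul, integral_one_sub_cos_mul_rpow h0 h1, rpow_add ht', rpow_one,
      smul_eq_mul, hC]
    field_simp
    exact div_self (by rw [mul_comm]; exact hS.ne')

theorem integrable_one_sub_cos_mul_weightSq {H : ℝ} (h0 : 0 < H) (h1 : H < 1) (t : ℝ) :
    Integrable (fun x => (1 - cos (t * x)) * weightSq H x) := by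
  rcases eq_or_ne t 0 with rfl | ht
  · simp
  · exact (integral_one_sub_cos_mul_weightSq_aux h0 h1 ht).1

theorem integral_one_sub_cos_mul_weightSq {H : ℝ} (h0 : 0 < H) (h1 : H < 1) (t : ℝ) :
    ∫ x, (1 - cos (t * x)) * weightSq H x = |t| ^ (2 * H) / 2 := by
  rcases eq_or_ne t 0 with rfl | ht
  · simp [zero_rpow (by linarith : 2 * H ≠ 0)]
  · exact (integral_one_sub_cos_mul_weightSq_aux h0 h1 ht).2

end FractionalIntegral

/-! ### Spectral weight and symbols of fractional Brownian motion. -/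

section Weight

open Set

/-- The integrand is of order x^(1-2H) near 0 and x^(-1-2H) at infinity. This is the source of every
L² majorant used for the Riemann–Stieltjes sums. -/
theorem integrable_min_sq_mul_weightSq {H : ℝ} (h0 : 0 < H) (h1 : H < 1) :
    Integrable fun x => min 1 |x| ^ 2 * weightSq H x := by
  have key : IntegrableOn (fun x : ℝ => min 1 x ^ 2 * x ^ (-1 - 2 * H)) (Ioi 0) := by
    rw [← Ioc_union_Ioi_eq_Ioi zero_le_one, integrableOn_union]
    constructor
    · have : IntegrableOn (fun x : ℝ => x ^ (1 - 2 * H)) (Ioc 0 1) := by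
        rw [← intervalIntegrable_iff_integrableOn_Ioc_of_le zero_le_one]
        exact intervalIntegral.intervalIntegrable_rpow' (by linarith)
      refine this.congr_fun (fun x hx => ?_) measurableSet_Ioc
      simp only
      rw [min_eq_right hx.2, ← Real.rpow_natCast, ← Real.rpow_add hx.1]
      congr 1
      push_cast
      ring
    · have : IntegrableOn (fun x : ℝ => x ^ (-1 - 2 * H)) (Ioi 1) :=
        integrableOn_Ioi_rpow_of_lt (by linarith) one_pos
      refine this.congr_fun (fun x hx => ?_) measurableSet_Ioi
      simp only
      rw [min_eq_left (le_of_lt hx)]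
      ring
  refine ((integrable_comp_abs key).const_mul
    (Real.Gamma (2 * H + 1) * Real.sin (Real.pi * H) / (2 * Real.pi))).congr
    (ae_of_all _ fun x => ?_)
  simp only [weightSq]
  ring

/-- The spectral weight of fractional Brownian motion. -/
def weight (H x : ℝ) : ℝ := Real.sqrt (weightSq H x)

@[fun_prop]
theorem measurable_weight (H : ℝ) : Measurable (weight H) := by
  unfold weight; fun_prop

theorem weight_nonneg (H x : ℝ) : 0 ≤ weight H x := Real.sqrt_nonneg _

theorem weight_sq {H : ℝ} (h0 : 0 < H) (h1 : H < 1) (x : ℝ) : weight H x ^ 2 = weightSq H x :=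
  Real.sq_sqrt (weightSq_nonneg h0 h1 x)

theorem memLp_min_mul_weight {H : ℝ} (h0 : 0 < H) (h1 : H < 1) :
    MemLp (fun x => min 1 |x| * weight H x) 2 volume := by
  rw [memLp_two_iff_integrable_sq (by fun_prop)]
  simp_rw [mul_pow, weight_sq h0 h1]
  exact integrable_min_sq_mul_weightSq h0 h1

/-- The character `x ↦ exp (i t x)`. -/
def char (t x : ℝ) : ℂ := Complex.exp (Complex.I * (t : ℂ) * (x : ℂ))

theorem char_eq (t x : ℝ) : char t x = Complex.exp ((t * x : ℝ) * Complex.I) := by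
  unfold char; push_cast; ring_nf

@[simp]
theorem norm_char (t x : ℝ) : ‖char t x‖ = 1 := by
  rw [char_eq, Complex.norm_exp_ofReal_mul_I]

theorem char_re (t x : ℝ) : (char t x).re = Real.cos (t * x) := by
  rw [char_eq, Complex.exp_ofReal_mul_I_re]

theorem char_im (t x : ℝ) : (char t x).im = Real.sin (t * x) := by
  rw [char_eq, Complex.exp_ofReal_mul_I_im]

@[simp]
theorem char_zero (x : ℝ) : char 0 x = 1 := by simp [char]

theorem char_add (s t x : ℝ) : char (s + t) x = char s x * char t x := by
  unfold char; rw [← Complex.exp_add]; push_cast; ring_nf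

@[fun_prop]
theorem measurable_char (t : ℝ) : Measurable (char t) := by
  unfold char; fun_prop

theorem inner_char_sub_one (s t x : ℝ) :
    (inner ℝ (char s x - 1) (char t x - 1) : ℝ) =
      (1 - Real.cos (t * x)) + (1 - Real.cos (s * x)) - (1 - Real.cos ((t - s) * x)) := by
  rw [Complex.inner]
  simp only [map_sub, map_one, Complex.mul_re, Complex.sub_re, Complex.sub_im, Complex.conj_re,
    Complex.conj_im, char_re, char_im, Complex.one_re, Complex.one_im]
  rw [sub_mul t s x, Real.cos_sub (t * x)]
  ring

theorem inner_mul_ofReal (z w : ℂ) (r : ℝ) :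
    (inner ℝ (z * r) (w * r) : ℝ) = inner ℝ z w * r ^ 2 := by
  simp only [Complex.inner, map_mul, Complex.conj_ofReal, Complex.mul_re, Complex.mul_im,
    Complex.ofReal_re, Complex.ofReal_im]
  ring

theorem inner_generators {H : ℝ} (h0 : 0 < H) (h1 : H < 1) (s t x : ℝ) :
    (inner ℝ ((char s x - 1) * (weight H x : ℂ)) ((char t x - 1) * (weight H x : ℂ)) : ℝ) =
      (1 - Real.cos (t * x)) * weightSq H x + (1 - Real.cos (s * x)) * weightSq H x -
        (1 - Real.cos ((t - s) * x)) * weightSq H x := by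
  rw [inner_mul_ofReal, inner_char_sub_one, weight_sq h0 h1]
  ring

/-- The inner product of two symbols is a combination of three terms 1 - cos, at t, s and t - s;
their integrals are the three terms of the covariance. -/
theorem IsFBM.isIsometric {Ω : Type*} [MeasurableSpace Ω] {P : Measure Ω} {H : ℝ}
    {B : ℝ → Ω → ℝ} (hB : IsFBM P H B) (h0 : 0 < H) (h1 : H < 1) :
    IsIsometric P volume B fun t x => (char t x - 1) * (weight H x : ℂ) where
  memLp_left t := (hB.gaussian.hasGaussianLaw_eval t).memLp_two
  memLp_right t := by
    rw [memLp_two_iff_integrable_sq_norm (by fun_prop)]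
    simp_rw [← real_inner_self_eq_norm_sq, inner_generators h0 h1]
    exact ((integrable_one_sub_cos_mul_weightSq h0 h1 _).add
      (integrable_one_sub_cos_mul_weightSq h0 h1 _)).sub
      (integrable_one_sub_cos_mul_weightSq h0 h1 _)
  centered := hB.centered
  inner_eq s t := by
    have I := integrable_one_sub_cos_mul_weightSq h0 h1
    simp_rw [hB.covariance, inner_generators h0 h1]
    rw [integral_sub (by exact (I t).add (I s)) (I _), integral_add (I t) (I s)]
    simp_rw [integral_one_sub_cos_mul_weightSq h0 h1]
    rw [abs_sub_comm t s]
    ring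

end Weight

/-! ### Action of the Ornstein–Uhlenbeck operators on symbols. -/

section OrnsteinUhlenbeck

theorem HasRSIntegral.tendsto {f y : ℝ → ℝ} {a b I : ℝ} (h : HasRSIntegral f y a b I)
    (hab : a ≤ b) :
    Tendsto (fun n : ℕ => ∑ i ∈ Finset.range (n + 1), f (a + i * ((b - a) / (n + 1))) *
      (y (a + (i + 1) * ((b - a) / (n + 1))) - y (a + i * ((b - a) / (n + 1))))) atTop (𝓝 I) := by
  rw [Metric.tendsto_atTop]
  intro ε hε
  obtain ⟨δ, hδ, H⟩ := h ε hε
  obtain ⟨N, hN⟩ := exists_nat_gt ((b - a) / δ)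
  refine ⟨N, fun n hn => ?_⟩
  have hn1 : (0 : ℝ) < n + 1 := by positivity
  have hh : 0 ≤ (b - a) / (n + 1) := div_nonneg (by linarith) hn1.le
  have := H (n + 1) (fun i => a + i * ((b - a) / (n + 1))) (fun i => a + i * ((b - a) / (n + 1)))
    (by simp) (by push_cast; field_simp; ring) ?_
  · simpa [Real.dist_eq] using this
  · intro i _
    refine ⟨le_rfl, ?_, ?_⟩
    · push_cast
      nlinarith
    · have h1 : (b - a) / (n + 1) < δ := by
        rw [div_lt_iff₀ hδ] at hN
        rw [div_lt_iff₀ hn1]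
        have : (N : ℝ) ≤ n := by exact_mod_cast hn
        nlinarith
      push_cast
      linarith

/-- The Ornstein–Uhlenbeck multiplier `i x / (l + i x)`. -/
def mult (l x : ℝ) : ℂ := (Complex.I * x) / (l + Complex.I * x)

theorem add_I_mul_ne_zero {l : ℝ} (hl : 0 < l) (x : ℝ) : (l : ℂ) + Complex.I * x ≠ 0 := by
  intro h
  have := congrArg Complex.re h
  simp at this
  exact hl.ne' this

theorem norm_mult_sq (l x : ℝ) : ‖mult l x‖ ^ 2 = x ^ 2 / (l ^ 2 + x ^ 2) := by
  rw [← Complex.normSq_eq_norm_sq, mult, Complex.normSq_div]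
  simp [Complex.normSq_apply]
  ring

theorem norm_mult_le_one {l : ℝ} (hl : 0 < l) (x : ℝ) : ‖mult l x‖ ≤ 1 := by
  rw [← sq_le_one_iff₀ (norm_nonneg _), norm_mult_sq, div_le_one (by positivity)]
  nlinarith

/-- The difference of the squared norms is (r - 1)(r + 1 - 2 Re u), and Re u ≤ 1 ≤ r. -/
theorem norm_sub_one_le_norm_mul_sub_one {u : ℂ} (hu : ‖u‖ = 1) {r : ℝ} (hr : 1 ≤ r) :
    ‖u - 1‖ ≤ ‖r * u - 1‖ := by
  have h1 : u.re * u.re + u.im * u.im = 1 := by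
    rw [← Complex.normSq_apply, Complex.normSq_eq_norm_sq, hu, one_pow]
  rw [← sq_le_sq₀ (norm_nonneg _) (norm_nonneg _), ← Complex.normSq_eq_norm_sq,
    ← Complex.normSq_eq_norm_sq, Complex.normSq_apply, Complex.normSq_apply]
  simp only [Complex.sub_re, Complex.sub_im, Complex.mul_re, Complex.mul_im, Complex.ofReal_re,
    Complex.ofReal_im, Complex.one_re, Complex.one_im, zero_mul, sub_zero, add_zero]
  have h2 : u.re ≤ 1 := by nlinarith
  have h3 : r ^ 2 * (u.re * u.re + u.im * u.im) = r ^ 2 := by rw [h1, mul_one]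
  linarith [mul_nonneg (sub_nonneg.2 hr) (by linarith : 0 ≤ r + 1 - 2 * u.re)]

/-- The bound is uniform in the step `h`. The factor |x|/l compares the numerator, at most |x|h,
with e^{lh} - 1 ≥ lh. -/
theorem norm_exp_sub_one_le {l h : ℝ} (hl : 0 < l) (hh : 0 < h) (x : ℝ) :
    ‖Complex.exp (Complex.I * x * h) - 1‖ ≤
      min 1 (|x| / l) * ‖Complex.exp ((l + Complex.I * x) * h) - 1‖ := by
  have hu : ‖Complex.exp (Complex.I * x * h)‖ = 1 := by
    rw [show Complex.I * x * h = Complex.I * ((x * h : ℝ) : ℂ) by push_cast; ring,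
      Complex.norm_exp_I_mul_ofReal]
  have hz : Complex.exp ((l + Complex.I * x) * h) =
      (Real.exp (l * h) : ℂ) * Complex.exp (Complex.I * x * h) := by
    rw [Complex.ofReal_exp, ← Complex.exp_add]; push_cast; ring_nf
  have hr : 1 ≤ Real.exp (l * h) := Real.one_le_exp (by positivity)
  rw [hz, min_mul_of_nonneg _ _ (norm_nonneg _), one_mul]
  refine le_min (norm_sub_one_le_norm_mul_sub_one hu hr) ?_
  have h1 : l * h ≤ ‖(Real.exp (l * h) : ℂ) * Complex.exp (Complex.I * x * h) - 1‖ := by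
    have h2 := norm_sub_norm_le ((Real.exp (l * h) : ℂ) * Complex.exp (Complex.I * x * h)) 1
    rw [norm_mul, hu, Complex.norm_real, Real.norm_of_nonneg (Real.exp_nonneg _), norm_one] at h2
    linarith [Real.add_one_le_exp (l * h)]
  calc ‖Complex.exp (Complex.I * x * h) - 1‖ ≤ |x| * h := by
        have := Real.norm_exp_I_mul_ofReal_sub_one_le (x := x * h)
        rw [Real.norm_eq_abs, abs_mul, abs_of_pos hh] at this
        simpa [mul_assoc] using this
    _ = |x| / l * (l * h) := by field_simp
    _ ≤ _ := by gcongr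

theorem exp_ne_one {l h : ℝ} (hl : 0 < l) (hh : 0 < h) (x : ℝ) :
    Complex.exp ((l + Complex.I * x) * h) ≠ 1 := by
  intro h1
  have h2 := congrArg norm h1
  rw [Complex.norm_exp, norm_one] at h2
  have h3 : 1 < Real.exp (l * h) := Real.one_lt_exp_iff.2 (by positivity)
  simp at h2
  rcases h2 with h2 | h2 <;> linarith

/-- The left-endpoint Riemann–Stieltjes sum of `s ↦ exp (-l (t - s))` against `s ↦ char s x` over
`[t - N, t]`, with `n + 1` steps of equal length. -/
def charSum (l t N : ℝ) (n : ℕ) (x : ℝ) : ℂ :=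
  ∑ i ∈ Finset.range (n + 1), (Real.exp (-l * (t - (t - N + i * (N / (n + 1))))) : ℂ) *
    (char (t - N + (i + 1) * (N / (n + 1))) x - char (t - N + i * (N / (n + 1))) x)

/-- The sum is geometric with ratio e^{(l+ix)h}, where h = N/(n+1). -/
theorem charSum_eq {l N : ℝ} (hl : 0 < l) (hN : 0 < N) (t : ℝ) (n : ℕ) (x : ℝ) :
    charSum l t N n x =
    Complex.exp (-l * N) * char (t - N) x * (Complex.exp ((l + Complex.I * x) * N) - 1) *
      ((Complex.exp (Complex.I * x * (N / (n + 1) : ℝ)) - 1) /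
        (Complex.exp ((l + Complex.I * x) * (N / (n + 1) : ℝ)) - 1)) := by
  have hz := exp_ne_one hl (h := N / (n + 1)) (by positivity) x
  unfold charSum
  set h : ℝ := N / (n + 1) with hh
  have hn1 : ((n : ℂ) + 1) ≠ 0 := by exact_mod_cast n.succ_ne_zero
  have e1 : Complex.exp ((l + Complex.I * x) * N) =
      Complex.exp ((l + Complex.I * x) * h) ^ (n + 1) := by
    rw [← Complex.exp_nat_mul, hh]
    congr 1
    push_cast
    field_simp
  have e2 : ∀ i : ℕ, (Real.exp (-l * (t - (t - N + i * h))) : ℂ) *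
      (char (t - N + (i + 1) * h) x - char (t - N + i * h) x) =
      Complex.exp (-l * N) * char (t - N) x * (Complex.exp (Complex.I * x * h) - 1) *
        Complex.exp ((l + Complex.I * x) * h) ^ i := by
    intro i
    rw [← Complex.exp_nat_mul]
    simp only [char, mul_sub, sub_mul, Complex.ofReal_exp, ← Complex.exp_add, mul_one]
    congr 2 <;> · push_cast; ring
  rw [Finset.sum_congr rfl fun i _ => e2 i, ← Finset.mul_sum, geom_sum_eq hz, e1]
  ring

/-- The constant 2 bounds 1 + e^{-lN}. Independence of both `n` and `N` is what allows domination in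
the two successive limits. -/
theorem norm_charSum_le {l N : ℝ} (hl : 0 < l) (hN : 0 < N) (t : ℝ) (n : ℕ) (x : ℝ) :
    ‖charSum l t N n x‖ ≤ 2 * min 1 (|x| / l) := by
  have hh : 0 < N / (n + 1) := by positivity
  have hz := sub_ne_zero.2 (exp_ne_one hl hh x)
  rw [charSum_eq hl hN, norm_mul, norm_mul, norm_mul, norm_char, mul_one, norm_div]
  have h1 : ‖Complex.exp (Complex.I * x * (N / (n + 1) : ℝ)) - 1‖ /
      ‖Complex.exp ((l + Complex.I * x) * (N / (n + 1) : ℝ)) - 1‖ ≤ min 1 (|x| / l) := by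
    rw [div_le_iff₀ (norm_pos_iff.2 hz)]
    exact norm_exp_sub_one_le hl hh x
  have h2 : ‖Complex.exp (-l * N)‖ * ‖Complex.exp ((l + Complex.I * x) * N) - 1‖ ≤ 2 := by
    calc _ ≤ ‖Complex.exp (-l * N)‖ * (‖Complex.exp ((l + Complex.I * x) * N)‖ + ‖(1 : ℂ)‖) := by
          gcongr; exact norm_sub_le _ _
      _ = 1 + Real.exp (-(l * N)) := by
          rw [Complex.norm_exp, Complex.norm_exp, mul_add, ← Real.exp_add]
          simp
      _ ≤ 2 := by
          have : Real.exp (-(l * N)) ≤ 1 := Real.exp_le_one_iff.2 (by nlinarith)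
          linarith
  exact mul_le_mul h2 h1 (by positivity) (by norm_num)

/-- After division by the step, this is a quotient of difference quotients at 0 of exponentials with
rates ix and l + ix. -/
theorem tendsto_exp_sub_one_div {l N : ℝ} (hl : 0 < l) (hN : 0 < N) (x : ℝ) :
    Tendsto (fun n : ℕ => (Complex.exp (Complex.I * x * (N / (n + 1) : ℝ)) - 1) /
      (Complex.exp ((l + Complex.I * x) * (N / (n + 1) : ℝ)) - 1)) atTop (𝓝 (mult l x)) := by
  have hh : Tendsto (fun n : ℕ => (N / (n + 1) : ℝ)) atTop (𝓝 0) := by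
    have := (tendsto_one_div_add_atTop_nhds_zero_nat (𝕜 := ℝ)).const_mul N
    simpa [div_eq_mul_inv] using this
  have hh' : Tendsto (fun n : ℕ => (((N / (n + 1) : ℝ)) : ℂ)) atTop (𝓝[≠] 0) := by
    refine tendsto_nhdsWithin_iff.2 ⟨?_, Eventually.of_forall fun n => ?_⟩
    · have := (Complex.continuous_ofReal.tendsto 0).comp hh
      rw [Complex.ofReal_zero] at this
      exact this
    · have : N / ((n : ℝ) + 1) ≠ 0 := by positivity
      exact Complex.ofReal_ne_zero.2 this
  have hd : ∀ c : ℂ, Tendsto (fun n : ℕ => (((N / (n + 1) : ℝ)) : ℂ)⁻¹ *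
      (Complex.exp (c * (N / (n + 1) : ℝ)) - 1)) atTop (𝓝 c) := by
    intro c
    have h1 : HasDerivAt (fun z : ℂ => Complex.exp (c * z)) c 0 := by
      have := ((hasDerivAt_id (0 : ℂ)).const_mul c).cexp
      simpa using this
    have := (hasDerivAt_iff_tendsto_slope_zero.1 h1).comp hh'
    simpa [Function.comp_def] using this
  refine ((hd (Complex.I * x)).div (hd (l + Complex.I * x)) (add_I_mul_ne_zero hl x)).congr ?_
  intro n
  refine mul_div_mul_left _ _ (inv_ne_zero ?_)
  have : N / ((n : ℝ) + 1) ≠ 0 := by positivity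
  exact_mod_cast this

theorem tendsto_charSum {l N : ℝ} (hl : 0 < l) (hN : 0 < N) (t x : ℝ) :
    Tendsto (fun n => charSum l t N n x) atTop
      (𝓝 (mult l x * (char t x - Complex.exp (-l * N) * char (t - N) x))) := by
  have h1 := (tendsto_exp_sub_one_div hl hN x).const_mul
    (Complex.exp (-l * N) * char (t - N) x * (Complex.exp ((l + Complex.I * x) * N) - 1))
  simp_rw [charSum_eq hl hN]
  convert h1 using 2
  rw [mul_comm (mult l x)]
  congr 1
  rw [mul_sub, mul_one, mul_right_comm, ← Complex.exp_add]
  congr 1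
  unfold char
  rw [← Complex.exp_add]
  push_cast
  ring_nf

/-- If the increments of `W` are represented by `m (char b - char a) w`, then the values of its
image under the Ornstein–Uhlenbeck operator `T_l` are represented by `mult l * m * char t * w`. -/
theorem isRepr_ou {Ω ι : Type*} [MeasurableSpace Ω] {P : Measure Ω} {B : ι → Ω → ℝ}
    {φ : ι → ℝ → ℂ} (hB : IsIsometric P volume B φ) {w : ℝ → ℝ} (hw0 : ∀ x, 0 ≤ w x)
    (hw : MemLp (fun x => min 1 |x| * w x) 2 volume) {m : ℝ → ℂ} {C : ℝ} (hm : ∀ x, ‖m x‖ ≤ C)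
    {l : ℝ} (hl : 0 < l) {W Z : Ω → ℝ → ℝ}
    (hW : ∀ a b, IsRepr P volume B φ (fun ω => W ω b - W ω a)
      (fun x => m x * (char b x - char a x) * w x))
    (hZ : ∀ᵐ ω ∂P, IsOU l (W ω) (Z ω)) (t : ℝ) :
    IsRepr P volume B φ (fun ω => Z ω t) (fun x => mult l x * m x * char t x * w x) := by
  have hC : 0 ≤ C := (norm_nonneg _).trans (hm 0)
  -- The factor 1 + 1/l converts min(1, |x|/l) into a multiple of min(1, |x|), which is square
  -- integrable against `w`.
  let D : ℝ → ℝ := fun x => C * (2 * (1 + 1 / l)) * (min 1 |x| * w x)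
  have hD : MemLp D 2 volume := hw.const_mul _
  have hbound : ∀ x, ∀ z : ℂ, ‖z‖ ≤ 2 * min 1 (|x| / l) → ‖m x * z * w x‖ ≤ D x := by
    intro x z hz
    have h1 : min 1 (|x| / l) ≤ (1 + 1 / l) * min 1 |x| := by
      have hl' : 0 < 1 / l := by positivity
      rcases le_total 1 |x| with h | h
      · rw [min_eq_left h]
        exact (min_le_left _ _).trans (by linarith)
      · rw [min_eq_right h]
        refine (min_le_right _ _).trans ?_
        rw [div_eq_mul_one_div]
        nlinarith [abs_nonneg x]
    rw [norm_mul, norm_mul, Complex.norm_real, Real.norm_of_nonneg (hw0 x)]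
    calc _ ≤ C * (2 * ((1 + 1 / l) * min 1 |x|)) * w x := by
          gcongr
          · exact hw0 x
          · exact hm x
          · exact hz.trans (by linarith)
      _ = D x := by simp only [D]; ring
  have hJ : ∀ᵐ ω ∂P, ∃ J : ℝ → ℝ,
      (∀ a ≤ t, HasRSIntegral (fun s => Real.exp (-l * (t - s))) (W ω) a t (J a)) ∧
        Tendsto J atBot (𝓝 (Z ω t)) := hZ.mono fun ω h => h t
  -- The choice of `J` need not be measurable in ω; representability of each value comes from the
  -- limit of the sums.
  obtain ⟨J, hJ⟩ := Filter.skolem.1 hJ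
  have hJN : ∀ N : ℝ, 0 < N → IsRepr P volume B φ (fun ω => J ω (t - N))
      (fun x => m x * (mult l x * (char t x - Complex.exp (-l * N) * char (t - N) x)) * w x) := by
    intro N hN
    refine IsRepr.of_tendsto hB (D := D) (ψ := fun n x => m x * charSum l t N n x * w x)
      (Y := fun n ω => ∑ i ∈ Finset.range (n + 1),
        Real.exp (-l * (t - (t - N + i * (N / (n + 1))))) *
          (W ω (t - N + (i + 1) * (N / (n + 1))) - W ω (t - N + i * (N / (n + 1)))))
      (fun n => ?_) ?_ hD (fun n => ae_of_all _ fun x => ?_) (ae_of_all _ fun x => ?_)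
    · refine (IsRepr.sum (Finset.range (n + 1)) fun (i : ℕ) _ => (hW (t - N + i * (N / (n + 1)))
        (t - N + (i + 1) * (N / (n + 1)))).const_mul
        (Real.exp (-l * (t - (t - N + i * (N / (n + 1))))))).congr (ae_of_all _ fun ω => rfl)
        (ae_of_all _ fun x => ?_)
      simp only [charSum]
      rw [Finset.mul_sum, Finset.sum_mul]
      exact Finset.sum_congr rfl fun i _ => by ring
    · filter_upwards [hJ] with ω hω
      have := (hω.1 (t - N) (by linarith)).tendsto (by linarith)
      simpa only [sub_sub_cancel] using this
    · exact hbound x _ (norm_charSum_le hl hN t n x)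
    · exact ((tendsto_charSum hl hN t x).const_mul _).mul_const _
  -- Second limit, N = n + 1 → ∞: the term from the lower endpoint has norm e^{-lN}.
  refine IsRepr.of_tendsto hB (D := D) (fun n : ℕ => hJN (n + 1) (by positivity)) ?_ hD
    (fun n => ae_of_all _ fun x => hbound x _ ?_) (ae_of_all _ fun x => ?_)
  · filter_upwards [hJ] with ω hω
    refine hω.2.comp (tendsto_atBot_add_const_left _ t ?_)
    exact tendsto_neg_atTop_atBot.comp
      (tendsto_atTop_add_const_right _ 1 tendsto_natCast_atTop_atTop)
  · exact le_of_tendsto (tendsto_charSum hl (by positivity : (0 : ℝ) < n + 1) t x).norm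
      (Eventually.of_forall fun k => norm_charSum_le hl (by positivity) t k x)
  · have hz : Tendsto (fun n : ℕ => Complex.exp (-l * ((n + 1 : ℝ) : ℂ)) * char (t - (n + 1)) x)
        atTop (𝓝 0) := by
      rw [tendsto_zero_iff_norm_tendsto_zero]
      simp_rw [norm_mul, norm_char, mul_one, Complex.norm_exp]
      refine Real.tendsto_exp_atBot.comp ?_
      have : Tendsto (fun n : ℕ => -(l * ((n : ℝ) + 1))) atTop atBot :=
        tendsto_neg_atTop_atBot.comp ((tendsto_atTop_add_const_right _ 1
          tendsto_natCast_atTop_atTop).const_mul_atTop hl)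
      simpa using this
    have := (((hz.const_sub (char t x)).const_mul (mult l x)).const_mul (m x)).mul_const (w x : ℂ)
    rw [sub_zero] at this
    convert this using 2
    ring

/-- The product of the Ornstein–Uhlenbeck multipliers of the parameters in a list. -/
def multProd (L : List ℝ) (x : ℝ) : ℂ := (L.map fun l => mult l x).prod

theorem norm_multProd_le_one {L : List ℝ} (hL : ∀ l ∈ L, 0 < l) (x : ℝ) :
    ‖multProd L x‖ ≤ 1 := by
  induction L with
  | nil => simp [multProd]
  | cons l L ih =>
    have h1 := norm_mult_le_one (hL l (by simp)) x
    have h2 := ih fun k hk => hL k (by simp [hk])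
    simp only [multProd, List.map_cons, List.prod_cons, norm_mul] at h2 ⊢
    exact mul_le_one₀ h1 (norm_nonneg _) h2

section Iterate

variable {Ω : Type*} [MeasurableSpace Ω] {P : Measure Ω} {H : ℝ} {B : ℝ → Ω → ℝ}

theorem isRepr_iterate_of_increments (hB : IsFBM P H B) (h0 : 0 < H) (h1 : H < 1) (σ : ℝ) {l : ℝ}
    {L : List ℝ} (hl : 0 < l) (hL : ∀ l ∈ L, 0 < l) {W Z : Ω → ℝ → ℝ}
    (hW : ∀ a b, IsRepr P volume B (fun t x => (char t x - 1) * (weight H x : ℂ))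
      (fun ω => W ω b - W ω a)
      (fun x => σ * multProd L x * (char b x - char a x) * weight H x))
    (hZ : ∀ᵐ ω ∂P, IsOU l (W ω) (Z ω)) (t : ℝ) :
    IsRepr P volume B (fun t x => (char t x - 1) * (weight H x : ℂ)) (fun ω => Z ω t)
      (fun x => σ * multProd (l :: L) x * char t x * weight H x) := by
  refine (isRepr_ou (hB.isIsometric h0 h1) (weight_nonneg H) (memLp_min_mul_weight h0 h1)
    (C := |σ|) (fun x => ?_) hl hW hZ t).congr (ae_of_all _ fun _ => rfl) (ae_of_all _ fun x => ?_)
  · rw [norm_mul, Complex.norm_real, Real.norm_eq_abs]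
    exact mul_le_of_le_one_right (abs_nonneg σ) (norm_multProd_le_one hL x)
  · simp only [multProd, List.map_cons, List.prod_cons]
    ring

/-- The induction runs on increments because the symbol of σB(t) carries char t - 1 and not char t.
Increments are all that a Riemann–Stieltjes integral sees, and they have the same form at every
stage. -/
theorem isRepr_increment_iterate (hB : IsFBM P H B) (h0 : 0 < H) (h1 : H < 1) (σ : ℝ)
    {L : List ℝ} (hL : ∀ l ∈ L, 0 < l) {Z : Ω → ℝ → ℝ}
    (hZ : ∀ᵐ ω ∂P, IsIteratedOU L (fun t => σ * B t ω) (Z ω)) (a b : ℝ) :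
    IsRepr P volume B (fun t x => (char t x - 1) * (weight H x : ℂ)) (fun ω => Z ω b - Z ω a)
      (fun x => σ * multProd L x * (char b x - char a x) * weight H x) := by
  induction L generalizing Z a b with
  | nil =>
    have hr := (hB.isIsometric h0 h1).isRepr
    refine (((hr b).sub (hr a)).const_mul σ).congr ?_ (ae_of_all _ fun x => ?_)
    · filter_upwards [hZ] with ω hω
      rw [show Z ω = fun t => σ * B t ω from hω]
      ring
    · simp only [multProd, List.map_nil, List.prod_nil]
      ring
  | cons l L ih =>
    obtain ⟨W, hW⟩ := Filter.skolem.1 (hZ.mono fun ω h => (h :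
      ∃ w, IsIteratedOU L (fun t => σ * B t ω) w ∧ IsOU l w (Z ω)))
    have hL' : ∀ l ∈ L, 0 < l := fun k hk => hL k (by simp [hk])
    have h := isRepr_iterate_of_increments hB h0 h1 σ (hL l (by simp)) hL'
      (ih hL' (hW.mono fun ω h => h.1)) (hW.mono fun ω h => h.2)
    refine ((h b).sub (h a)).congr (ae_of_all _ fun _ => rfl) (ae_of_all _ fun x => ?_)
    ring

theorem isRepr_iterate (hB : IsFBM P H B) (h0 : 0 < H) (h1 : H < 1) (σ : ℝ)
    {L : List ℝ} (hL : ∀ l ∈ L, 0 < l) (hne : L ≠ []) {Z : Ω → ℝ → ℝ}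
    (hZ : ∀ᵐ ω ∂P, IsIteratedOU L (fun t => σ * B t ω) (Z ω)) (t : ℝ) :
    IsRepr P volume B (fun t x => (char t x - 1) * (weight H x : ℂ)) (fun ω => Z ω t)
      (fun x => σ * multProd L x * char t x * weight H x) := by
  obtain ⟨l, L, rfl⟩ := List.exists_cons_of_ne_nil hne
  obtain ⟨W, hW⟩ := Filter.skolem.1 (hZ.mono fun ω h => (h :
    ∃ w, IsIteratedOU L (fun t => σ * B t ω) w ∧ IsOU l w (Z ω)))
  have hL' : ∀ l ∈ L, 0 < l := fun k hk => hL k (by simp [hk])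
  exact isRepr_iterate_of_increments hB h0 h1 σ (hL l (by simp)) hL'
    (isRepr_increment_iterate hB h0 h1 σ hL' (hW.mono fun ω h => h.1)) (hW.mono fun ω h => h.2) t

end Iterate

end OrnsteinUhlenbeck

/-! ### Decay of cosine transforms by two integrations by parts. -/

section Decay

open Set Real

theorem integrableOn_Ioi_of_rpow_bounds {F : ℝ → ℝ} (hF : Measurable F) {C a b : ℝ} (ha : -1 < a)
    (hb : b < -1) (h0 : ∀ x, 0 < x → |F x| ≤ C * x ^ a)
    (h1 : ∀ x, 1 < x → |F x| ≤ C * x ^ b) : IntegrableOn F (Ioi 0) := by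
  rw [← Ioc_union_Ioi_eq_Ioi zero_le_one, integrableOn_union]
  constructor
  · have : IntegrableOn (fun x : ℝ => C * x ^ a) (Ioc 0 1) := by
      refine Integrable.const_mul ?_ C
      rw [← IntegrableOn, ← intervalIntegrable_iff_integrableOn_Ioc_of_le zero_le_one]
      exact intervalIntegral.intervalIntegrable_rpow' ha
    refine Integrable.mono' this hF.aestronglyMeasurable ?_
    filter_upwards [ae_restrict_mem measurableSet_Ioc] with x hx using h0 x hx.1
  · have : IntegrableOn (fun x : ℝ => C * x ^ b) (Ioi 1) :=
      (integrableOn_Ioi_rpow_of_lt hb one_pos).const_mul C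
    refine Integrable.mono' this hF.aestronglyMeasurable ?_
    filter_upwards [ae_restrict_mem measurableSet_Ioi] with x hx using h1 x hx

theorem tendsto_zero_of_le_rpow {F : ℝ → ℝ} {C a : ℝ} (ha : 0 < a)
    (h0 : ∀ x, 0 < x → |F x| ≤ C * x ^ a) : Tendsto F (𝓝[>] 0) (𝓝 0) := by
  have h : Tendsto (fun x : ℝ => C * x ^ a) (𝓝[>] 0) (𝓝 0) := by
    have := ((continuousAt_rpow_const 0 a (Or.inr ha.le)).tendsto.mono_left
      (nhdsWithin_le_nhds (s := Ioi 0))).const_mul C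
    simpa [zero_rpow ha.ne'] using this
  refine squeeze_zero_norm' ?_ h
  filter_upwards [self_mem_nhdsWithin] with x hx using h0 x hx

theorem tendsto_atTop_zero_of_le_rpow {F : ℝ → ℝ} {C b : ℝ} (hb : b < 0)
    (h1 : ∀ x, 1 < x → |F x| ≤ C * x ^ b) : Tendsto F atTop (𝓝 0) := by
  have h : Tendsto (fun x : ℝ => C * x ^ b) atTop (𝓝 0) := by
    have := (tendsto_rpow_neg_atTop (y := -b) (by linarith)).const_mul C
    simpa using this
  refine squeeze_zero_norm' ?_ h
  filter_upwards [eventually_gt_atTop 1] with x hx using h1 x hx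

theorem tendsto_zero_mul_of_abs_le {F v : ℝ → ℝ} {l : Filter ℝ} {K : ℝ}
    (hF : Tendsto F l (𝓝 0)) (hv : ∀ x, |v x| ≤ K) : Tendsto (fun x => F x * v x) l (𝓝 0) := by
  have h : Tendsto (fun x => |F x| * K) l (𝓝 0) := by
    simpa using hF.abs.mul_const K
  refine squeeze_zero_norm (fun x => ?_) h
  rw [norm_mul, norm_eq_abs, norm_eq_abs]
  exact mul_le_mul_of_nonneg_left (hv x) (abs_nonneg _)

theorem integrableOn_mul_of_abs_le {F v : ℝ → ℝ} {s : Set ℝ} {K : ℝ} (hF : IntegrableOn F s)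
    (hv : Measurable v) (hK : ∀ x, |v x| ≤ K) : IntegrableOn (fun x => F x * v x) s :=
  Integrable.mul_bdd hF hv.aestronglyMeasurable (ae_of_all _ hK)

/-- Each integration by parts gains 1/t; the boundary terms vanish by the limits assumed at 0 and
infinity. -/
theorem abs_integral_cos_mul_le {f f' f'' : ℝ → ℝ}
    (hf : ∀ x ∈ Ioi (0 : ℝ), HasDerivAt f (f' x) x)
    (hf' : ∀ x ∈ Ioi (0 : ℝ), HasDerivAt f' (f'' x) x)
    (hi : IntegrableOn f (Ioi 0)) (hi' : IntegrableOn f' (Ioi 0)) (hi'' : IntegrableOn f'' (Ioi 0))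
    (h0 : Tendsto f (𝓝[>] 0) (𝓝 0)) (h0' : Tendsto f' (𝓝[>] 0) (𝓝 0))
    (h1 : Tendsto f atTop (𝓝 0)) (h1' : Tendsto f' atTop (𝓝 0)) {t : ℝ} (ht : t ≠ 0) :
    |∫ x in Ioi (0 : ℝ), f x * cos (t * x)| ≤ (∫ x in Ioi (0 : ℝ), |f'' x|) / t ^ 2 := by
  have hd : ∀ x ∈ Ioi (0 : ℝ), HasDerivAt (fun x => sin (t * x) / t) (cos (t * x)) x := by
    intro x _
    have := (((hasDerivAt_id x).const_mul t).sin).div_const t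
    simpa [ht] using this
  have hd' : ∀ x ∈ Ioi (0 : ℝ), HasDerivAt (fun x => -cos (t * x) / t ^ 2) (sin (t * x) / t) x := by
    intro x _
    have := (((hasDerivAt_id x).const_mul t).cos).neg.div_const (t ^ 2)
    have e : sin (t * x) / t = -(-sin (t * id x) * (t * 1)) / t ^ 2 := by
      simp only [id_eq]
      field_simp
    rw [e]
    exact this
  have b1 : ∀ x, |sin (t * x) / t| ≤ 1 / |t| := fun x => by
    rw [abs_div]; gcongr; exact abs_sin_le_one _
  have b2 : ∀ x, |-cos (t * x) / t ^ 2| ≤ 1 / t ^ 2 := fun x => by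
    rw [abs_div, abs_neg, abs_of_pos (by positivity : 0 < t ^ 2)]; gcongr; exact abs_cos_le_one _
  have e1 := integral_Ioi_mul_deriv_eq_deriv_mul hf hd
    (integrableOn_mul_of_abs_le hi (by fun_prop) fun x => abs_cos_le_one (t * x))
    (integrableOn_mul_of_abs_le hi' (by fun_prop) b1)
    (tendsto_zero_mul_of_abs_le h0 b1) (tendsto_zero_mul_of_abs_le h1 b1)
  have e2 := integral_Ioi_mul_deriv_eq_deriv_mul hf' hd'
    (integrableOn_mul_of_abs_le hi' (by fun_prop) b1)
    (integrableOn_mul_of_abs_le hi'' (by fun_prop) b2)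
    (tendsto_zero_mul_of_abs_le h0' b2) (tendsto_zero_mul_of_abs_le h1' b2)
  rw [e1, e2]
  simp only [sub_self, zero_sub, neg_neg]
  rw [← norm_eq_abs, ← integral_div]
  refine norm_integral_le_of_norm_le (hi''.abs.div_const _) (ae_of_all _ fun x => ?_)
  rw [norm_mul, norm_eq_abs, norm_eq_abs, div_eq_mul_one_div |f'' x|]
  exact mul_le_mul_of_nonneg_left (b2 x) (abs_nonneg _)

variable {ι : Type*} [Fintype ι] (lam κ : ι → ℝ) (a : ℝ)

/-- The logarithm of `x ^ a / ∏ i, (lam i ^ 2 + x ^ 2) ^ κ i`, for `0 < x`. -/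
def logProfile (x : ℝ) : ℝ := a * log x - ∑ i, κ i * log (lam i ^ 2 + x ^ 2)

/-- The derivative of `logProfile`. -/
def logProfileDeriv (x : ℝ) : ℝ := a / x - ∑ i, κ i * (2 * x / (lam i ^ 2 + x ^ 2))

/-- The second derivative of `logProfile`. -/
def logProfileDeriv2 (x : ℝ) : ℝ :=
  -a / x ^ 2 - ∑ i, κ i * (2 * (lam i ^ 2 - x ^ 2) / (lam i ^ 2 + x ^ 2) ^ 2)

variable {lam κ a}

theorem hasDerivAt_logProfile {x : ℝ} (hx : 0 < x) :
    HasDerivAt (logProfile lam κ a) (logProfileDeriv lam κ a x) x := by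
  unfold logProfile logProfileDeriv
  refine HasDerivAt.sub ?_ (HasDerivAt.fun_sum fun i _ => HasDerivAt.const_mul _ ?_)
  · simpa [div_eq_mul_inv] using (hasDerivAt_log hx.ne').const_mul a
  · have h : HasDerivAt (fun x : ℝ => lam i ^ 2 + x ^ 2) (2 * x) x := by
      simpa using (hasDerivAt_pow 2 x).const_add (lam i ^ 2)
    exact h.log (by positivity)

theorem hasDerivAt_logProfileDeriv {x : ℝ} (hx : 0 < x) :
    HasDerivAt (logProfileDeriv lam κ a) (logProfileDeriv2 lam κ a x) x := by
  unfold logProfileDeriv logProfileDeriv2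
  refine HasDerivAt.sub ?_ (HasDerivAt.fun_sum fun i _ => HasDerivAt.const_mul _ ?_)
  · have := (hasDerivAt_inv hx.ne').const_mul a
    simpa [← div_eq_mul_inv, neg_div] using this
  · have h : HasDerivAt (fun x : ℝ => lam i ^ 2 + x ^ 2) (2 * x) x := by
      simpa using (hasDerivAt_pow 2 x).const_add (lam i ^ 2)
    have h2 : HasDerivAt (fun x : ℝ => 2 * x) 2 x := by
      simpa using (hasDerivAt_id x).const_mul 2
    convert h2.div h (by positivity) using 1
    congr 1
    ring

theorem abs_logProfileDeriv_le (hκ : ∀ i, 0 ≤ κ i) (ha : 0 ≤ a) {x : ℝ} (hx : 0 < x) :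
    |logProfileDeriv lam κ a x| ≤ (a + 2 * ∑ i, κ i) / x := by
  unfold logProfileDeriv
  refine (abs_sub _ _).trans ?_
  rw [add_div, abs_of_nonneg (div_nonneg ha hx.le), Finset.mul_sum, Finset.sum_div]
  gcongr
  refine (Finset.abs_sum_le_sum_abs _ _).trans (Finset.sum_le_sum fun i _ => ?_)
  rw [abs_mul, abs_of_nonneg (hκ i), abs_of_nonneg (by positivity),
    show 2 * κ i / x = κ i * (2 / x) by ring]
  refine mul_le_mul_of_nonneg_left ?_ (hκ i)
  rw [div_le_div_iff₀ (by positivity) hx]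
  nlinarith [sq_nonneg (lam i)]

theorem abs_logProfileDeriv2_le (hκ : ∀ i, 0 ≤ κ i) (ha : 0 ≤ a) {x : ℝ} (hx : 0 < x) :
    |logProfileDeriv2 lam κ a x| ≤ (a + 2 * ∑ i, κ i) / x ^ 2 := by
  unfold logProfileDeriv2
  refine (abs_sub _ _).trans ?_
  rw [add_div, neg_div, abs_neg, abs_of_nonneg (div_nonneg ha (by positivity)), Finset.mul_sum,
    Finset.sum_div]
  gcongr
  refine (Finset.abs_sum_le_sum_abs _ _).trans (Finset.sum_le_sum fun i _ => ?_)
  rw [abs_mul, abs_of_nonneg (hκ i), show 2 * κ i / x ^ 2 = κ i * (2 / x ^ 2) by ring]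
  refine mul_le_mul_of_nonneg_left ?_ (hκ i)
  rw [abs_div, abs_of_pos (by positivity : 0 < (lam i ^ 2 + x ^ 2) ^ 2), abs_mul, abs_two]
  have h1 : |lam i ^ 2 - x ^ 2| ≤ lam i ^ 2 + x ^ 2 :=
    abs_le.2 ⟨by nlinarith [sq_nonneg (lam i)], by nlinarith [sq_nonneg x]⟩
  calc _ ≤ 2 * (lam i ^ 2 + x ^ 2) / (lam i ^ 2 + x ^ 2) ^ 2 := by gcongr
    _ = 2 / (lam i ^ 2 + x ^ 2) := by field_simp
    _ ≤ 2 / x ^ 2 := by gcongr; nlinarith [sq_nonneg (lam i)]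

/-- Dropping x² from each denominator gives the bound that is useful near 0; dropping lam² instead
gives the one at infinity. -/
theorem exp_logProfile_le_of_pos (hlam : ∀ i, 0 < lam i) (hκ : ∀ i, 0 ≤ κ i) {x : ℝ}
    (hx : 0 < x) :
    exp (logProfile lam κ a x) ≤ exp (-∑ i, κ i * log (lam i ^ 2)) * x ^ a := by
  rw [rpow_def_of_pos hx, ← exp_add, exp_le_exp, logProfile]
  have : ∑ i, κ i * log (lam i ^ 2) ≤ ∑ i, κ i * log (lam i ^ 2 + x ^ 2) := by
    refine Finset.sum_le_sum fun i _ => mul_le_mul_of_nonneg_left ?_ (hκ i)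
    have := hlam i
    exact log_le_log (by positivity) (by nlinarith)
  linarith

theorem exp_logProfile_le (hκ : ∀ i, 0 ≤ κ i) {x : ℝ} (hx : 0 < x) :
    exp (logProfile lam κ a x) ≤ x ^ (a - 2 * ∑ i, κ i) := by
  rw [rpow_def_of_pos hx, exp_le_exp, logProfile]
  have : ∑ i, κ i * (2 * log x) ≤ ∑ i, κ i * log (lam i ^ 2 + x ^ 2) := by
    refine Finset.sum_le_sum fun i _ => mul_le_mul_of_nonneg_left ?_ (hκ i)
    rw [show 2 * log x = log (x ^ 2) by rw [log_pow]; norm_num]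
    exact log_le_log (by positivity) (by nlinarith [sq_nonneg (lam i)])
  rw [← Finset.sum_mul] at this
  linarith

/-- For E = e^g, E' = E g' and E'' = E(g'² + g''), with g' = O(1/x) and g'' = O(1/x²), so each
derivative costs at most a factor 1/x. Since a > 1, E and E' vanish at 0 and E'' = O(x^(a-2)) is
integrable there; at infinity all three are O(x^b) with b < -1. -/
theorem exists_abs_integral_cos_mul_exp_logProfile_le (hlam : ∀ i, 0 < lam i)
    (hκ : ∀ i, 0 ≤ κ i) (ha : 1 < a) (hb : a - 2 * ∑ i, κ i < -1) :
    ∃ C, ∀ t : ℝ, t ≠ 0 →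
      |∫ x in Ioi (0 : ℝ), exp (logProfile lam κ a x) * cos (t * x)| ≤ C / t ^ 2 := by
  set E : ℝ → ℝ := fun x => exp (logProfile lam κ a x) with hE
  set k := logProfileDeriv lam κ a with hk
  set k' := logProfileDeriv2 lam κ a with hk'
  set A := a + 2 * ∑ i, κ i with hA
  set C₀ := exp (-∑ i, κ i * log (lam i ^ 2)) with hC₀
  set b := a - 2 * ∑ i, κ i with hbdef
  have hA0 : 0 ≤ A := by
    have := Finset.sum_nonneg fun i (_ : i ∈ Finset.univ) => hκ i
    linarith
  have mE : Measurable E := by unfold E logProfile; fun_prop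
  have mk : Measurable k := by unfold k logProfileDeriv; fun_prop
  have mk' : Measurable k' := by unfold k' logProfileDeriv2; fun_prop
  have bk : ∀ x, 0 < x → |k x| ≤ A / x := fun x hx => abs_logProfileDeriv_le hκ (by linarith) hx
  have bk' : ∀ x, 0 < x → |k' x| ≤ A / x ^ 2 := fun x hx =>
    abs_logProfileDeriv2_le hκ (by linarith) hx
  have bE0 : ∀ x, 0 < x → E x ≤ C₀ * x ^ a := fun x hx => exp_logProfile_le_of_pos hlam hκ hx
  have bE1 : ∀ x, 0 < x → E x ≤ x ^ b := fun x hx => exp_logProfile_le hκ hx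
  have E0 : ∀ x, 0 ≤ E x := fun x => (exp_pos _).le
  have C0 : 0 ≤ C₀ := (exp_pos _).le
  have d1 : ∀ x, 0 < x → |E x * k x| ≤ A * (E x / x) := fun x hx => by
    rw [abs_mul, abs_of_nonneg (E0 x)]
    calc _ ≤ E x * (A / x) := mul_le_mul_of_nonneg_left (bk x hx) (E0 x)
      _ = _ := by ring
  have d2 : ∀ x, 0 < x → |E x * k x * k x + E x * k' x| ≤ (A ^ 2 + A) * (E x / x ^ 2) := by
    intro x hx
    have h1 : |k x * k x + k' x| ≤ (A ^ 2 + A) / x ^ 2 := by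
      refine (abs_add_le _ _).trans ?_
      rw [abs_mul, add_div]
      have h2 : |k x| * |k x| ≤ A / x * (A / x) :=
        mul_le_mul (bk x hx) (bk x hx) (abs_nonneg _) (by positivity)
      have h3 : A / x * (A / x) = A ^ 2 / x ^ 2 := by field_simp
      linarith [bk' x hx]
    rw [show E x * k x * k x + E x * k' x = E x * (k x * k x + k' x) by ring, abs_mul,
      abs_of_nonneg (E0 x)]
    calc _ ≤ E x * ((A ^ 2 + A) / x ^ 2) := mul_le_mul_of_nonneg_left h1 (E0 x)
      _ = _ := by ring
  -- The constant C₀ + 1 serves both bounds, C₀ x^a and x^b; for x > 1 division by x^j only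
  -- decreases.
  have small : ∀ (F : ℝ → ℝ) (D : ℝ) (j : ℕ), 0 ≤ D → (∀ x, 0 < x → |F x| ≤ D * (E x / x ^ j)) →
      (∀ x, 0 < x → |F x| ≤ D * (C₀ + 1) * x ^ (a - j)) ∧
        ∀ x, 1 < x → |F x| ≤ D * (C₀ + 1) * x ^ b := by
    intro F D j hD h
    refine ⟨fun x hx => (h x hx).trans ?_, fun x hx => (h x (by linarith)).trans ?_⟩
    · rw [rpow_sub hx, rpow_natCast]
      have := rpow_nonneg hx.le a
      calc D * (E x / x ^ j) ≤ D * ((C₀ + 1) * x ^ a / x ^ j) := by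
            gcongr
            nlinarith [bE0 x hx]
        _ = _ := by ring
    · rw [mul_assoc]
      have hx0 : 0 < x := by linarith
      have := rpow_nonneg hx0.le b
      gcongr
      refine (div_le_self (E0 x) (one_le_pow₀ hx.le)).trans ?_
      nlinarith [bE1 x hx0]
  obtain ⟨s0, t0⟩ := small E 1 0 zero_le_one fun x hx => by simp [abs_of_nonneg (E0 x)]
  obtain ⟨s1, t1⟩ := small (fun x => E x * k x) A 1 hA0 fun x hx => by simpa using d1 x hx
  obtain ⟨s2, t2⟩ := small (fun x => E x * k x * k x + E x * k' x) (A ^ 2 + A) 2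
    (by positivity) d2
  have D1 : ∀ x ∈ Ioi (0 : ℝ), HasDerivAt E (E x * k x) x := fun x hx =>
    (hasDerivAt_logProfile hx).exp
  refine ⟨_, fun t ht => abs_integral_cos_mul_le D1
    (fun x hx => (D1 x hx).mul (hasDerivAt_logProfileDeriv hx))
    (integrableOn_Ioi_of_rpow_bounds mE ?_ hb s0 t0)
    (integrableOn_Ioi_of_rpow_bounds (mE.mul mk) ?_ hb s1 t1)
    (integrableOn_Ioi_of_rpow_bounds (((mE.mul mk).mul mk).add (mE.mul mk')) ?_ hb s2 t2)
    (tendsto_zero_of_le_rpow ?_ s0) (tendsto_zero_of_le_rpow ?_ s1)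
    (tendsto_atTop_zero_of_le_rpow ?_ t0) (tendsto_atTop_zero_of_le_rpow ?_ t1) ht⟩
  all_goals push_cast; linarith

end Decay

/-! ### The density as squared modulus of the symbol. -/

section Density

variable {q : ℕ} {lam : Fin q → ℝ} {p : Fin q → ℕ} {σ H : ℝ}

theorem density_neg (x : ℝ) : density lam p σ H (-x) = density lam p σ H x := by
  simp [density]

theorem density_abs (x : ℝ) : density lam p σ H |x| = density lam p σ H x := by
  simp [density]

theorem density_nonneg (h0 : 0 < H) (h1 : H < 1) (x : ℝ) : 0 ≤ density lam p σ H x := by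
  have hG : 0 < Real.Gamma (2 * H + 1) := Real.Gamma_pos_of_pos (by linarith)
  have hS := sin_mul_pi_pos h0 h1
  rw [mul_comm] at hS
  have : 0 ≤ ∏ i, (lam i ^ 2 + x ^ 2) ^ (p i) := Finset.prod_nonneg fun i _ => by positivity
  unfold density
  positivity

theorem continuousAt_density_zero (hlam : ∀ i, 0 < lam i) (h1 : H < 1) (hp : 2 ≤ ∑ i, p i) :
    ContinuousAt (density lam p σ H) 0 := by
  have hp' : (2 : ℝ) ≤ ((∑ i, p i : ℕ) : ℝ) := by exact_mod_cast hp
  have hprod : (0 : ℝ) < ∏ i, (lam i ^ 2 + (0 : ℝ) ^ 2) ^ (p i) :=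
    Finset.prod_pos fun i _ => by have := hlam i; positivity
  unfold density
  refine ContinuousAt.div ?_ (by fun_prop) (by positivity)
  exact continuousAt_const.mul (continuousAt_id.abs.rpow_const (Or.inr (by linarith)))

theorem mem_rates {l : ℝ} (h : l ∈ rates lam p) : ∃ i, l = lam i := by
  simp only [rates, List.mem_flatMap, List.mem_replicate] at h
  obtain ⟨i, _, _, h⟩ := h
  exact ⟨i, h⟩

theorem rates_ne_nil (hq : 0 < q) (hp : ∀ i, 1 ≤ p i) : rates lam p ≠ [] := by
  refine List.ne_nil_of_mem (a := lam ⟨0, hq⟩) ?_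
  simp only [rates, List.mem_flatMap, List.mem_replicate]
  exact ⟨⟨0, hq⟩, List.mem_finRange _, by have := hp ⟨0, hq⟩; omega, rfl⟩

theorem multProd_rates (x : ℝ) : multProd (rates lam p) x = ∏ i, mult (lam i) x ^ p i := by
  have h : ∀ L : List (Fin q),
      ((L.flatMap fun i => List.replicate (p i) (lam i)).map fun l => mult l x).prod =
        (L.map fun i => mult (lam i) x ^ p i).prod := by
    intro L
    induction L with
    | nil => rfl
    | cons i L ih => simp [List.flatMap_cons, ih]
  rw [multProd, rates, h, Fin.prod_univ_def]

/-- The point 0 is excluded because real powers there follow conventions: for p = 1 and H = 1/2 the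
density contains 0^0 = 1 while the symbol vanishes. -/
theorem norm_sq_symbol (h0 : 0 < H) (h1 : H < 1) {x : ℝ} (hx : x ≠ 0) :
    ‖(σ : ℂ) * multProd (rates lam p) x * weight H x‖ ^ 2 = density lam p σ H x := by
  have hx' : 0 < |x| := abs_pos.2 hx
  rw [norm_mul, norm_mul, mul_pow, mul_pow, Complex.norm_real, Complex.norm_real,
    Real.norm_of_nonneg (weight_nonneg H x), weight_sq h0 h1, Real.norm_eq_abs, sq_abs,
    multProd_rates, norm_prod, ← Finset.prod_pow]
  simp_rw [norm_pow, pow_right_comm _ _ 2, norm_mult_sq, div_pow]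
  rw [Finset.prod_div_distrib, Finset.prod_pow_eq_pow_sum, density, weightSq,
    show 2 * ((∑ i, p i : ℕ) : ℝ) - 1 - 2 * H = (-1 - 2 * H) + ((2 * ∑ i, p i : ℕ) : ℝ) by
      push_cast; ring, Real.rpow_add hx', Real.rpow_natCast, pow_mul, sq_abs, mul_comm H]
  ring

theorem density_eq_exp_logProfile {x : ℝ} (hx : 0 < x) :
    density lam p σ H x =
      σ ^ 2 * Real.Gamma (2 * H + 1) * Real.sin (H * Real.pi) / (2 * Real.pi) *
        Real.exp (logProfile lam (fun i => (p i : ℝ))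
          (2 * ((∑ i, p i : ℕ) : ℝ) - 1 - 2 * H) x) := by
  have h : ∀ i, Real.exp (p i * Real.log (lam i ^ 2 + x ^ 2)) = (lam i ^ 2 + x ^ 2) ^ p i := by
    intro i
    rw [Real.exp_nat_mul, Real.exp_log (by positivity)]
  rw [logProfile, Real.exp_sub, Real.exp_sum, density, abs_of_pos hx, Real.rpow_def_of_pos hx,
    mul_comm (Real.log x)]
  simp_rw [h]
  rw [div_mul_div_comm]

end Density

/-! ### Autocovariance, spectral density and short memory. -/

section Autocovariance

theorem inner_self_mul (z c : ℂ) : (inner ℝ z (z * c) : ℝ) = ‖z‖ ^ 2 * c.re := by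
  rw [← Complex.normSq_eq_norm_sq, Complex.normSq_apply]
  simp only [Complex.inner, Complex.mul_re, Complex.mul_im, Complex.conj_re, Complex.conj_im]
  ring

variable {Ω : Type*} [MeasurableSpace Ω] {P : Measure Ω}
  {q : ℕ} {lam : Fin q → ℝ} {p : Fin q → ℕ} {σ H : ℝ} {X : ℝ → Ω → ℝ}

theorem ae_ne_zero : ∀ᵐ x : ℝ, x ≠ 0 := by
  simp [ae_iff]

theorem IsFOU.exists_isRepr (hX : IsFOU P lam p σ H X) (hq : 0 < q) (hlam : ∀ i, 0 < lam i)
    (hp : ∀ i, 1 ≤ p i) (h0 : 0 < H) (h1 : H < 1) :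
    ∃ B : ℝ → Ω → ℝ, IsFBM P H B ∧ ∀ t,
      IsRepr P volume B (fun t x => (char t x - 1) * (weight H x : ℂ)) (X t)
        (fun x => σ * multProd (rates lam p) x * char t x * weight H x) := by
  obtain ⟨B, hB, hXB⟩ := hX
  refine ⟨B, hB, isRepr_iterate hB h0 h1 σ (fun l hl => ?_) (rates_ne_nil hq hp)
    (Z := fun ω t => X t ω) hXB⟩
  obtain ⟨i, rfl⟩ := mem_rates hl
  exact hlam i

/-- A time shift by t multiplies the symbol by the unimodular e^{itx}, so the real inner product is
the squared modulus times cos(tx), whatever `s` is. -/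
theorem IsFOU.integral_mul (hX : IsFOU P lam p σ H X) (hq : 0 < q) (hlam : ∀ i, 0 < lam i)
    (hp : ∀ i, 1 ≤ p i) (h0 : 0 < H) (h1 : H < 1) (s t : ℝ) :
    ∫ ω, X s ω * X (s + t) ω ∂P = ∫ x, density lam p σ H x * Real.cos (t * x) := by
  obtain ⟨B, hB, hr⟩ := hX.exists_isRepr hq hlam hp h0 h1
  rw [(hr s).integral_mul (hB.isIsometric h0 h1) (hr (s + t))]
  refine integral_congr_ae (ae_ne_zero.mono fun x hx => ?_)
  simp only
  rw [show (σ : ℂ) * multProd (rates lam p) x * char (s + t) x * weight H x =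
      (σ * multProd (rates lam p) x * char s x * weight H x) * char t x by
      rw [char_add]; ring, inner_self_mul, char_re, ← norm_sq_symbol h0 h1 hx]
  simp only [norm_mul, norm_char, mul_one]

theorem IsFOU.autocov_eq (hX : IsFOU P lam p σ H X) (hq : 0 < q) (hlam : ∀ i, 0 < lam i)
    (hp : ∀ i, 1 ≤ p i) (h0 : 0 < H) (h1 : H < 1) (t : ℝ) :
    autocov P X t = ∫ x, density lam p σ H x * Real.cos (t * x) := by
  simpa [autocov] using hX.integral_mul hq hlam hp h0 h1 0 t

theorem IsFOU.isCenteredStationary [IsFiniteMeasure P] (hX : IsFOU P lam p σ H X) (hq : 0 < q)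
    (hlam : ∀ i, 0 < lam i) (hp : ∀ i, 1 ≤ p i) (h0 : 0 < H) (h1 : H < 1) :
    IsCenteredStationary P X := by
  obtain ⟨B, hB, hr⟩ := hX.exists_isRepr hq hlam hp h0 h1
  exact
    { memLp := fun t => (hr t).memLp
      centered := fun t => (hr t).integral_eq_zero (hB.isIsometric h0 h1)
      stationary := fun s t => by
        rw [hX.integral_mul hq hlam hp h0 h1, hX.autocov_eq hq hlam hp h0 h1] }

/-- No estimate is needed: the symbol of X_0 lies in L² and the density is its squared modulus
almost everywhere. -/
theorem IsFOU.integrable_density (hX : IsFOU P lam p σ H X) (hq : 0 < q)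
    (hlam : ∀ i, 0 < lam i) (hp : ∀ i, 1 ≤ p i) (h0 : 0 < H) (h1 : H < 1) :
    Integrable (density lam p σ H) := by
  obtain ⟨B, hB, hr⟩ := hX.exists_isRepr hq hlam hp h0 h1
  have h := (hr 0).memLp_right
  rw [memLp_two_iff_integrable_sq_norm h.1] at h
  refine h.congr (ae_ne_zero.mono fun x hx => ?_)
  simp only [char_zero, mul_one]
  exact norm_sq_symbol h0 h1 hx

theorem integral_exp_mul_ofReal_of_even {f : ℝ → ℝ} (hf : Integrable f) (heven : ∀ x, f (-x) = f x)
    (t : ℝ) :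
    ∫ x : ℝ, Complex.exp (Complex.I * (t : ℂ) * (x : ℂ)) * (f x : ℂ) =
      ((∫ x, f x * Real.cos (t * x) : ℝ) : ℂ) := by
  have hi : Integrable fun x : ℝ => char t x * (f x : ℂ) :=
    hf.ofReal.bdd_mul (c := 1) (by fun_prop) (ae_of_all _ fun x => by simp)
  -- An odd integrand, so the imaginary part vanishes.
  have hsin : ∫ x, f x * Real.sin (t * x) = 0 := by
    have h := integral_neg_eq_self (fun x => f x * Real.sin (t * x)) volume
    simp only [heven, mul_neg, Real.sin_neg, integral_neg] at h
    linarith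
  have hre := integral_re (𝕜 := ℂ) hi
  have him := integral_im (𝕜 := ℂ) hi
  simp only [RCLike.re_eq_complex_re, RCLike.im_eq_complex_im, Complex.mul_re, Complex.mul_im,
    Complex.ofReal_re, Complex.ofReal_im, char_re, char_im, mul_zero, sub_zero, zero_add] at hre him
  change ∫ x, char t x * (f x : ℂ) = _
  refine Complex.ext ?_ ?_
  · rw [← hre, Complex.ofReal_re]
    simp_rw [mul_comm (f _)]
  · rw [← him, Complex.ofReal_im, ← hsin]
    simp_rw [mul_comm (f _)]

theorem IsFOU.isSpectralDensity [IsFiniteMeasure P] (hX : IsFOU P lam p σ H X) (hq : 0 < q)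
    (hlam : ∀ i, 0 < lam i) (hp : ∀ i, 1 ≤ p i) (h0 : 0 < H) (h1 : H < 1) :
    IsSpectralDensity P X (density lam p σ H) where
  process := hX.isCenteredStationary hq hlam hp h0 h1
  nonneg := density_nonneg h0 h1
  integrable := hX.integrable_density hq hlam hp h0 h1
  autocov_eq t := by
    rw [integral_exp_mul_ofReal_of_even (hX.integrable_density hq hlam hp h0 h1) density_neg,
      hX.autocov_eq hq hlam hp h0 h1]

theorem exists_abs_integral_density_mul_cos_le (hlam : ∀ i, 0 < lam i) (h0 : 0 < H) (h1 : H < 1)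
    (hp : 2 ≤ ∑ i, p i) :
    ∃ C, ∀ t : ℝ, t ≠ 0 → |∫ x, density lam p σ H x * Real.cos (t * x)| ≤ C / t ^ 2 := by
  have hp' : (2 : ℝ) ≤ ((∑ i, p i : ℕ) : ℝ) := by exact_mod_cast hp
  obtain ⟨C, hC⟩ := exists_abs_integral_cos_mul_exp_logProfile_le hlam
    (κ := fun i => (p i : ℝ)) (a := 2 * ((∑ i, p i : ℕ) : ℝ) - 1 - 2 * H)
    (fun i => Nat.cast_nonneg _) (by linarith) (by push_cast; linarith)
  set K := σ ^ 2 * Real.Gamma (2 * H + 1) * Real.sin (H * Real.pi) / (2 * Real.pi)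
  refine ⟨2 * (|K| * C), fun t ht => ?_⟩
  have e : ∫ x, density lam p σ H x * Real.cos (t * x) =
      2 * (K * ∫ x in Set.Ioi (0 : ℝ), Real.exp (logProfile lam (fun i => (p i : ℝ))
        (2 * ((∑ i, p i : ℕ) : ℝ) - 1 - 2 * H) x) * Real.cos (t * x)) := by
    rw [← integral_const_mul]
    calc _ = ∫ x, (fun y => density lam p σ H y * Real.cos (t * y)) |x| := by
          refine integral_congr_ae (ae_of_all _ fun x => ?_)
          simp only [density_abs]
          rw [← Real.cos_abs (t * x), ← Real.cos_abs (t * |x|), abs_mul, abs_mul, abs_abs]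
      _ = _ := by
          rw [integral_comp_abs (f := fun y => density lam p σ H y * Real.cos (t * y))]
          congr 1
          refine setIntegral_congr_fun measurableSet_Ioi fun x hx => ?_
          rw [density_eq_exp_logProfile hx, mul_assoc]
  rw [e, abs_mul, abs_mul, abs_two, mul_div_assoc, mul_div_assoc]
  exact mul_le_mul_of_nonneg_left (mul_le_mul_of_nonneg_left (hC t ht) (abs_nonneg _)) two_pos.le

theorem IsFOU.shortMemory (hX : IsFOU P lam p σ H X) (hq : 0 < q)
    (hlam : ∀ i, 0 < lam i) (hp : ∀ i, 1 ≤ p i) (h0 : 0 < H) (h1 : H < 1)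
    (hp2 : 2 ≤ ∑ i, p i) : ShortMemory P X := by
  obtain ⟨C, hC⟩ := exists_abs_integral_density_mul_cos_le (σ := σ) hlam h0 h1 hp2
  have hs : Summable fun n : ℤ => C * (1 / (n : ℝ) ^ 2) :=
    (Real.summable_one_div_int_pow.2 one_lt_two).mul_left C
  refine Summable.of_norm_bounded_eventually hs ?_
  -- The t⁻² bound says nothing at lag 0, and a single term does not affect summability.
  have hn : ∀ᶠ n : ℤ in cofinite, n ≠ 0 := by
    rw [eventually_cofinite]
    simp
  filter_upwards [hn] with n hn
  rw [Real.norm_eq_abs, abs_abs, hX.autocov_eq hq hlam hp h0 h1, mul_one_div]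
  exact hC n (by exact_mod_cast hn)

end Autocovariance

end FOU

end

theorem theorem2 {Ω : Type*} [MeasurableSpace Ω] (P : Measure Ω) [IsProbabilityMeasure P]
    {q : ℕ} (hq : 0 < q) (lam : Fin q → ℝ) (hlam : ∀ i, 0 < lam i)
    (hinj : Function.Injective lam) (p : Fin q → ℕ) (hp : ∀ i, 1 ≤ p i)
    (σ H : ℝ) (hσ : 0 < σ) (hH0 : 0 < H) (hH1 : H < 1)
    (X : ℝ → Ω → ℝ) (hX : FOU.IsFOU P lam p σ H X) :
    FOU.IsSpectralDensity P X (FOU.density lam p σ H) ∧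
    ((∀ i, p i = 1) →
      FOU.IsSpectralDensity P X fun x =>
        σ ^ 2 * Real.Gamma (2 * H + 1) * Real.sin (H * Real.pi) *
            |x| ^ (2 * (q : ℝ) - 1 - 2 * H) /
          (2 * Real.pi * ∏ i, (lam i ^ 2 + x ^ 2))) ∧
    (2 ≤ ∑ i, p i →
      ContinuousAt (FOU.density lam p σ H) 0 ∧ FOU.ShortMemory P X) := by
  have hf := hX.isSpectralDensity hq hlam hp hH0 hH1
  refine ⟨hf, fun h => ?_, fun h =>
    ⟨FOU.continuousAt_density_zero hlam hH1 h, hX.shortMemory hq hlam hp hH0 hH1 h⟩⟩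
  convert hf using 2 with x
  simp [FOU.density, h]
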